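/- Theorem 4.3 (Laplacian with nonlocal boundary conditions). On the (real or complex) Hilbert space $L^2(0,1)$ consider the operator $$\operatorname{dom}(A) = \{v \in H^2(0,1) : v'(0) = -v'(1) = v(0)+v(1)\}, \qquad Av = v''.$$ Then $A$ is self-adjoint and generates a unique $C_0$-semigroup $(e^{tA})_{t\ge 0}$ on $L^2(0,1)$, and this semigroup is uniformly eventually positive: there exists a time $t_0 \ge 0$ such that, for every $u_0 \in L^2(0,1)$ with $u_0 \ge 0$ almost everywhere and every $t \ge t_0$, one has $e^{tA}u_0 \ge 0$ almost everywhere. -/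

import Mathlib

open MeasureTheory Set Filter Topology
open scoped ContDiff NNReal

/-- Lebesgue measure on the open unit interval `(0,1)`. -/
noncomputable abbrev unitIntervalMeasure : Measure ℝ := volume.restrict (Ioo (0 : ℝ) 1)

/-- The Hilbert space `L²(0,1)` with scalars in `𝕜` (`ℝ` or `ℂ`). -/
abbrev L2UnitInterval (𝕜 : Type*) [RCLike 𝕜] : Type _ := Lp 𝕜 2 unitIntervalMeasure

section SobolevSpace

variable {𝕜 : Type*} [RCLike 𝕜]

/-- `w ∈ L²(0,1)` is a weak derivative of `v ∈ L²(0,1)`: for all test functions `φ ∈ C_c^∞(0,1)`,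
`∫ φ' v = - ∫ φ w`. -/
def HasWeakDeriv (v w : L2UnitInterval 𝕜) : Prop :=
  ∀ φ : ℝ → ℝ, ContDiff ℝ ∞ φ → HasCompactSupport φ → tsupport φ ⊆ Ioo 0 1 →
    ∫ x in Ioo (0 : ℝ) 1, deriv φ x • v x = - ∫ x in Ioo (0 : ℝ) 1, φ x • w x

open Classical in
/-- The weak derivative `v' ∈ L²(0,1)` of `v ∈ L²(0,1)`; by convention it is `0` if `v` has no
weak derivative in `L²(0,1)`. -/
noncomputable def weakDeriv (v : L2UnitInterval 𝕜) : L2UnitInterval 𝕜 :=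
  if h : ∃ w, HasWeakDeriv v w then h.choose else 0

theorem integrable_contDiff_smul {φ : ℝ → ℝ} (hφ : Continuous φ) (hc : HasCompactSupport φ)
    (v : L2UnitInterval 𝕜) : Integrable (fun x => φ x • v x) unitIntervalMeasure := by
  obtain ⟨C, hC⟩ := hc.exists_bound_of_continuous hφ
  exact ((Lp.memLp v).integrable (by norm_num)).bdd_smul C
    hφ.aestronglyMeasurable (Eventually.of_forall hC)

theorem HasWeakDeriv.add {v₁ v₂ w₁ w₂ : L2UnitInterval 𝕜} (h₁ : HasWeakDeriv v₁ w₁)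
    (h₂ : HasWeakDeriv v₂ w₂) : HasWeakDeriv (v₁ + v₂) (w₁ + w₂) := by
  intro φ hφ hc hs
  have e₁ : ∀ (ψ : ℝ → ℝ) (a b : L2UnitInterval 𝕜), Continuous ψ → HasCompactSupport ψ →
      ∫ x in Ioo (0 : ℝ) 1, ψ x • (a + b) x =
        (∫ x in Ioo (0 : ℝ) 1, ψ x • a x) + ∫ x in Ioo (0 : ℝ) 1, ψ x • b x := by
    intro ψ a b hψ hcψ
    rw [← integral_add (integrable_contDiff_smul hψ hcψ a) (integrable_contDiff_smul hψ hcψ b)]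
    refine integral_congr_ae ?_
    filter_upwards [Lp.coeFn_add a b] with x hx
    rw [hx, Pi.add_apply, smul_add]
  rw [e₁ _ _ _ (hφ.continuous_deriv (by simp)) hc.deriv, e₁ _ _ _ hφ.continuous hc,
    h₁ φ hφ hc hs, h₂ φ hφ hc hs, neg_add]

theorem HasWeakDeriv.smul {v w : L2UnitInterval 𝕜} (c : 𝕜) (h : HasWeakDeriv v w) :
    HasWeakDeriv (c • v) (c • w) := by
  intro φ hφ hc hs
  have e : ∀ (ψ : ℝ → ℝ) (a : L2UnitInterval 𝕜),
      ∫ x in Ioo (0 : ℝ) 1, ψ x • (c • a) x = c • ∫ x in Ioo (0 : ℝ) 1, ψ x • a x := by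
    intro ψ a
    rw [← integral_smul]
    refine integral_congr_ae ?_
    filter_upwards [Lp.coeFn_smul c a] with x hx
    rw [hx, Pi.smul_apply, smul_comm]
  rw [e, e, h φ hφ hc hs, smul_neg]

theorem HasWeakDeriv.zero : HasWeakDeriv (0 : L2UnitInterval 𝕜) 0 := by
  intro φ _ _ _
  have e : ∀ ψ : ℝ → ℝ, ∫ x in Ioo (0 : ℝ) 1, ψ x • (0 : L2UnitInterval 𝕜) x = 0 := by
    intro ψ
    rw [integral_eq_zero_of_ae]
    filter_upwards [Lp.coeFn_zero 𝕜 2 unitIntervalMeasure] with x hx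
    rw [hx, Pi.zero_apply, smul_zero]
  rw [e, e, neg_zero]

theorem HasWeakDeriv.unique {v w₁ w₂ : L2UnitInterval 𝕜} (h₁ : HasWeakDeriv v w₁)
    (h₂ : HasWeakDeriv v w₂) : w₁ = w₂ := by
  have hloc : ∀ w : L2UnitInterval 𝕜, IntegrableOn w (Ioo (0 : ℝ) 1) volume := fun w =>
    (Lp.memLp w).integrable (by norm_num)
  have key : ∀ᵐ x ∂volume, x ∈ Ioo (0 : ℝ) 1 → (w₁ x - w₂ x) = 0 := by
    refine isOpen_Ioo.ae_eq_zero_of_integral_contDiff_smul_eq_zero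
      ((hloc w₁).sub (hloc w₂)).locallyIntegrableOn ?_
    intro φ hφ hc hs
    have h := (h₁ φ hφ hc hs).symm.trans (h₂ φ hφ hc hs)
    rw [← setIntegral_eq_integral_of_forall_compl_eq_zero (s := Ioo (0 : ℝ) 1)]
    · simp only [smul_sub]
      rw [integral_sub (integrable_contDiff_smul hφ.continuous hc w₁)
        (integrable_contDiff_smul hφ.continuous hc w₂), sub_eq_zero]
      exact neg_injective h
    · intro x hx
      rw [image_eq_zero_of_notMem_tsupport (fun h' => hx (hs h')), zero_smul]
  refine Lp.ext ?_
  filter_upwards [(ae_restrict_iff' measurableSet_Ioo).2 key] with x hx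
  exact sub_eq_zero.1 hx

theorem HasWeakDeriv.weakDeriv_eq {v w : L2UnitInterval 𝕜} (h : HasWeakDeriv v w) :
    weakDeriv v = w := by
  have hex : ∃ w, HasWeakDeriv v w := ⟨w, h⟩
  rw [weakDeriv, dif_pos hex]
  exact hex.choose_spec.unique h

variable (𝕜) in
/-- The Sobolev space `H²(0,1)`: all `v ∈ L²(0,1)` whose first and second weak derivatives exist
in `L²(0,1)`. -/
def sobolevH2 : Submodule 𝕜 (L2UnitInterval 𝕜) where
  carrier := {v | ∃ v' v'' : L2UnitInterval 𝕜, HasWeakDeriv v v' ∧ HasWeakDeriv v' v''}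
  zero_mem' := ⟨0, 0, HasWeakDeriv.zero, HasWeakDeriv.zero⟩
  add_mem' := by
    rintro _ _ ⟨a, b, h, k⟩ ⟨a', b', h', k'⟩
    exact ⟨a + a', b + b', h.add h', k.add k'⟩
  smul_mem' := by
    rintro c _ ⟨a, b, h, k⟩
    exact ⟨c • a, c • b, h.smul c, k.smul c⟩

theorem weakDeriv_add_of_mem {u v : L2UnitInterval 𝕜} (hu : u ∈ sobolevH2 𝕜)
    (hv : v ∈ sobolevH2 𝕜) : weakDeriv (u + v) = weakDeriv u + weakDeriv v ∧
      weakDeriv (weakDeriv (u + v)) = weakDeriv (weakDeriv u) + weakDeriv (weakDeriv v) := by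
  obtain ⟨a, b, h, k⟩ := hu
  obtain ⟨a', b', h', k'⟩ := hv
  rw [(h.add h').weakDeriv_eq, (k.add k').weakDeriv_eq, h.weakDeriv_eq, h'.weakDeriv_eq,
    k.weakDeriv_eq, k'.weakDeriv_eq]
  exact ⟨rfl, rfl⟩

theorem weakDeriv_smul_of_mem (c : 𝕜) {u : L2UnitInterval 𝕜} (hu : u ∈ sobolevH2 𝕜) :
    weakDeriv (c • u) = c • weakDeriv u ∧
      weakDeriv (weakDeriv (c • u)) = c • weakDeriv (weakDeriv u) := by
  obtain ⟨a, b, h, k⟩ := hu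
  rw [(h.smul c).weakDeriv_eq, (k.smul c).weakDeriv_eq, h.weakDeriv_eq, k.weakDeriv_eq]
  exact ⟨rfl, rfl⟩

/-- `u ∈ L²(0,1)` has a representative that is continuous on `[0,1]`, and this (necessarily unique)
representative takes the values `u(0) = a` and `u(1) = b`. -/
def HasBoundaryValues (u : L2UnitInterval 𝕜) (a b : 𝕜) : Prop :=
  ∃ f : ℝ → 𝕜, ContinuousOn f (Icc 0 1) ∧ u =ᵐ[unitIntervalMeasure] f ∧ f 0 = a ∧ f 1 = b

theorem HasBoundaryValues.add {u v : L2UnitInterval 𝕜} {a b c d : 𝕜}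
    (hu : HasBoundaryValues u a b) (hv : HasBoundaryValues v c d) :
    HasBoundaryValues (u + v) (a + c) (b + d) := by
  obtain ⟨f, hf, huf, rfl, rfl⟩ := hu
  obtain ⟨g, hg, hvg, rfl, rfl⟩ := hv
  exact ⟨f + g, hf.add hg, (Lp.coeFn_add u v).trans (huf.add hvg), rfl, rfl⟩

theorem HasBoundaryValues.smul (c : 𝕜) {u : L2UnitInterval 𝕜} {a b : 𝕜}
    (hu : HasBoundaryValues u a b) : HasBoundaryValues (c • u) (c * a) (c * b) := by
  obtain ⟨f, hf, huf, rfl, rfl⟩ := hu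
  exact ⟨c • f, hf.const_smul c, (Lp.coeFn_smul c u).trans (huf.const_smul c), rfl, rfl⟩

theorem HasBoundaryValues.zero : HasBoundaryValues (0 : L2UnitInterval 𝕜) 0 0 :=
  ⟨0, continuousOn_const, Lp.coeFn_zero 𝕜 2 unitIntervalMeasure, rfl, rfl⟩

variable (𝕜) in
/-- The domain `{v ∈ H²(0,1) : v'(0) = -v'(1) = v(0) + v(1)}`. -/
def nonlocalLaplacianDomain : Submodule 𝕜 (L2UnitInterval 𝕜) where
  carrier := {v | v ∈ sobolevH2 𝕜 ∧ ∃ v₀ v₁ d₀ d₁ : 𝕜,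
    HasBoundaryValues v v₀ v₁ ∧ HasBoundaryValues (weakDeriv v) d₀ d₁ ∧
      d₀ = -d₁ ∧ -d₁ = v₀ + v₁}
  zero_mem' := by
    refine ⟨zero_mem _, 0, 0, 0, 0, HasBoundaryValues.zero, ?_, by simp, by simp⟩
    rw [HasWeakDeriv.zero.weakDeriv_eq]
    exact HasBoundaryValues.zero
  add_mem' := by
    rintro u v ⟨hu, a, b, c, d, h₁, h₂, h₃, h₄⟩ ⟨hv, a', b', c', d', h₁', h₂', h₃', h₄'⟩
    refine ⟨add_mem hu hv, a + a', b + b', c + c', d + d', h₁.add h₁', ?_, ?_, ?_⟩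
    · rw [(weakDeriv_add_of_mem hu hv).1]
      exact h₂.add h₂'
    · rw [h₃, h₃', neg_add]
    · rw [neg_add, h₄, h₄']
      ring
  smul_mem' := by
    rintro r u ⟨hu, a, b, c, d, h₁, h₂, h₃, h₄⟩
    refine ⟨Submodule.smul_mem _ r hu, r * a, r * b, r * c, r * d, h₁.smul r, ?_, ?_, ?_⟩
    · rw [(weakDeriv_smul_of_mem r hu).1]
      exact h₂.smul r
    · rw [h₃, mul_neg]
    · rw [← mul_neg, h₄, mul_add]

variable (𝕜) in
/-- The unbounded operator `A v = v''` on `L²(0,1)` with domain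
`{v ∈ H²(0,1) : v'(0) = -v'(1) = v(0) + v(1)}`. -/
noncomputable def nonlocalLaplacian : L2UnitInterval 𝕜 →ₗ.[𝕜] L2UnitInterval 𝕜 where
  domain := nonlocalLaplacianDomain 𝕜
  toFun :=
    { toFun := fun v => weakDeriv (weakDeriv (v : L2UnitInterval 𝕜))
      map_add' := fun u v => (weakDeriv_add_of_mem u.2.1 v.2.1).2
      map_smul' := fun c u => (weakDeriv_smul_of_mem c u.2.1).2 }

end SobolevSpace

/-- A `C₀`-semigroup (strongly continuous one-parameter semigroup of bounded linear operators). -/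
structure C0Semigroup (𝕜 E : Type*) [RCLike 𝕜] [NormedAddCommGroup E] [NormedSpace 𝕜 E] where
  /-- the operator at time `t` -/
  op : ℝ≥0 → E →L[𝕜] E
  op_zero : op 0 = ContinuousLinearMap.id 𝕜 E
  op_add : ∀ s t : ℝ≥0, op (s + t) = (op s).comp (op t)
  continuous_orbit : ∀ x : E, Continuous fun t : ℝ≥0 => op t x

/-- `A` is the generator of the semigroup `T`: the domain of `A` consists exactly of those `v` for
which `lim_{t ↓ 0} (T t v - v) / t` exists, and `A v` is this limit. -/
def C0Semigroup.IsGeneratedBy {𝕜 E : Type*} [RCLike 𝕜] [NormedAddCommGroup E] [NormedSpace 𝕜 E]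
    (T : C0Semigroup 𝕜 E) (A : E →ₗ.[𝕜] E) : Prop :=
  ∀ v w : E, (∃ h : v ∈ A.domain, A ⟨v, h⟩ = w) ↔
    Tendsto (fun t : ℝ≥0 => (((t : ℝ) : 𝕜))⁻¹ • (T.op t v - v)) (𝓝[>] 0) (𝓝 w)

/-- `f ≥ 0`, that is, `f(x)` is real and nonnegative for almost every `x ∈ (0,1)`. -/
def IsPositiveL2 {𝕜 : Type*} [RCLike 𝕜] (f : L2UnitInterval 𝕜) : Prop :=
  ∀ᵐ x ∂unitIntervalMeasure, 0 ≤ RCLike.re (f x) ∧ RCLike.im (f x) = 0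

/-- Uniform eventual positivity: there is a time `t₀`, independent of the initial value, such that
`T t u₀ ≥ 0` for all `t ≥ t₀` and all initial values `u₀ ≥ 0`. -/
def C0Semigroup.UniformlyEventuallyPositive {𝕜 : Type*} [RCLike 𝕜]
    (T : C0Semigroup 𝕜 (L2UnitInterval 𝕜)) : Prop :=
  ∃ t₀ : ℝ≥0, ∀ u₀ : L2UnitInterval 𝕜, IsPositiveL2 u₀ →
    ∀ t : ℝ≥0, t₀ ≤ t → IsPositiveL2 (T.op t u₀)

/-! ### Semigroups that are diagonal in a Hilbert basis -/

section DiagonalOperators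

variable {𝕜 H ι : Type*} [RCLike 𝕜] [NormedAddCommGroup H] [InnerProductSpace 𝕜 H]

/-! The operator `-A` has an explicit inverse, the integral operator `G = greenOp` with kernel `(1 -
|x - y|) / 2`: the graph of `A` is `{(v, w) | v = -G w}` (`nonlocalLaplacian_eq_iff`). Since the
kernel is real and symmetric, `G` is symmetric, so this graph equals its own adjoint and `A` is
self-adjoint. Since `G f` is Lipschitz with constant controlled by `‖f‖`, `G` is compact. Hence
there is a Hilbert basis of eigenvectors of `G`, in which `A` is maximally diagonal, and `e^{tA}` is
the diagonal operator with entries `exp (-t l)`, where `-l` runs through the eigenvalues of `A`. Any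
semigroup generated by `A` must act in this way on eigenvectors, which gives uniqueness.

For positivity, the equation `v'' = -l v` is solved in functions that are even or odd about `1/2`.
No `l < 0` occurs, and below `π²` the only eigenvalue of `-A` is `4 a²`, where `a sin a = cos a` and
`0 < a < π/2`. It is simple, with eigenfunction `φ(x) = cos (2 a (x - 1/2)) ≥ cos a > 0`
(`greenOp_eigenvalue`).

For `t ≥ 1` the semigroup is therefore its rank-one part on `φ` plus a remainder `G D G`, where `D`
is diagonal with entries `l² exp (-t l)` over `l ≥ π²` (`exists_diagonalSemigroup_eq_add`). The
factor `G` maps `L¹` to `L²` and `L²` to `L^∞`, so the remainder is pointwise at most a constant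
times `exp (-t π²) ‖u‖₁`. For `u ≥ 0` the rank-one part is at least `exp (-4 a² t) cos² a ‖u‖₁`.
Both are measured by the same `L¹` norm, and `4 a² < π²`, so the rank-one part wins after a time
that does not depend on `u`. Over `ℂ`, the values are real because `e^{tA}` commutes with
conjugation. -/

theorem HilbertBasis.ext_inner (b : HilbertBasis ι 𝕜 H) {x y : H}
    (h : ∀ i, inner 𝕜 (b i) x = inner 𝕜 (b i) y) : x = y := by
  apply b.repr.injective
  ext i
  rw [b.repr_apply_apply, b.repr_apply_apply, h]

theorem HilbertBasis.hasSum_norm_inner_sq (b : HilbertBasis ι 𝕜 H) (x : H) :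
    HasSum (fun i => ‖inner 𝕜 (b i) x‖ ^ 2) (‖x‖ ^ 2) := by
  have := lp.hasSum_norm (p := 2) (by norm_num) (b.repr x)
  simpa [b.repr_apply_apply] using this

/-- Convergence of coordinates together with a square summable majorant implies convergence. -/
theorem HilbertBasis.tendsto_of_tendsto_inner (b : HilbertBasis ι 𝕜 H) {α : Type*} {l : Filter α}
    {f : α → H} {y : H} (g : H) (hb : ∀ᶠ a in l, ∀ i, ‖inner 𝕜 (b i) (f a)‖ ≤ ‖inner 𝕜 (b i) g‖)
    (hf : ∀ i, Tendsto (fun a => inner 𝕜 (b i) (f a)) l (𝓝 (inner 𝕜 (b i) y))) :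
    Tendsto f l (𝓝 y) := by
  rw [tendsto_iff_norm_sub_tendsto_zero]
  have h : Tendsto (fun a => ‖f a - y‖ ^ 2) l (𝓝 0) := by
    have e : ∀ a, ‖f a - y‖ ^ 2 = ∑' i, ‖inner 𝕜 (b i) (f a) - inner 𝕜 (b i) y‖ ^ 2 := by
      intro a
      simp_rw [← inner_sub_right]
      exact (b.hasSum_norm_inner_sq _).tsum_eq.symm
    simp_rw [e]
    have h0 : (0 : ℝ) = ∑' _ : ι, (0 : ℝ) := by simp
    rw [h0]
    refine tendsto_tsum_of_dominated_convergence
      (bound := fun i => 2 * (‖inner 𝕜 (b i) g‖ ^ 2 + ‖inner 𝕜 (b i) y‖ ^ 2))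
      (((b.hasSum_norm_inner_sq g).add (b.hasSum_norm_inner_sq y)).summable.mul_left 2) ?_ ?_
    · intro i
      have := ((hf i).sub_const (inner 𝕜 (b i) y)).norm.pow 2
      simpa using this
    · filter_upwards [hb] with a ha i
      rw [Real.norm_of_nonneg (by positivity)]
      have h1 := norm_sub_le (inner 𝕜 (b i) (f a)) (inner 𝕜 (b i) y)
      have h2 := ha i
      have h3 := norm_nonneg (inner 𝕜 (b i) (f a) - inner 𝕜 (b i) y)
      have h4 := norm_nonneg (inner 𝕜 (b i) y)
      calc _ ≤ (‖inner 𝕜 (b i) g‖ + ‖inner 𝕜 (b i) y‖) ^ 2 := by gcongr; linarith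
        _ ≤ _ := by nlinarith [sq_nonneg (‖inner 𝕜 (b i) g‖ - ‖inner 𝕜 (b i) y‖)]
  simpa using h.sqrt

theorem Memℓp.ofReal_mul {x : ι → 𝕜} (hx : Memℓp x 2) {m : ι → ℝ} {C : ℝ≥0}
    (hm : ∀ i, |m i| ≤ C) : Memℓp (fun i => (m i : 𝕜) * x i) 2 := by
  refine Memℓp.mono' (hx.const_smul ((C : ℝ) : 𝕜)) fun i => ?_
  rw [Pi.smul_apply, norm_smul, norm_mul, RCLike.norm_ofReal, RCLike.norm_ofReal, NNReal.abs_eq]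
  gcongr
  exact hm i

/-- The bounded operator that is diagonal with respect to a Hilbert basis, with real entries. -/
noncomputable def HilbertBasis.diagonal (b : HilbertBasis ι 𝕜 H) (m : ι → ℝ) (C : ℝ≥0)
    (hm : ∀ i, |m i| ≤ C) : H →L[𝕜] H :=
  LinearMap.mkContinuous
    { toFun := fun x => b.repr.symm ⟨fun i => (m i : 𝕜) * b.repr x i, (lp.memℓp _).ofReal_mul hm⟩
      map_add' := fun x y => by
        rw [← map_add]
        congr 1
        ext i
        simp only [map_add, lp.coeFn_add, Pi.add_apply]
        exact mul_add _ _ _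
      map_smul' := fun c x => by
        rw [← map_smul]
        congr 1
        ext i
        simp [mul_left_comm] } C fun x => by
    rw [LinearMap.coe_mk, AddHom.coe_mk, LinearIsometryEquiv.norm_map, ← b.repr.norm_map x]
    have h : ‖((C : ℝ) : 𝕜) • b.repr x‖ = C * ‖b.repr x‖ := by
      rw [norm_smul, RCLike.norm_ofReal, NNReal.abs_eq]
    rw [← h]
    refine lp.norm_mono (by norm_num) fun i => ?_
    rw [lp.coeFn_smul, Pi.smul_apply, norm_smul, norm_mul, RCLike.norm_ofReal, RCLike.norm_ofReal,
      NNReal.abs_eq]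
    gcongr
    exact hm i

theorem HilbertBasis.inner_diagonal (b : HilbertBasis ι 𝕜 H) (m : ι → ℝ) (C : ℝ≥0)
    (hm : ∀ i, |m i| ≤ C) (x : H) (i : ι) :
    inner 𝕜 (b i) (b.diagonal m C hm x) = m i * inner 𝕜 (b i) x := by
  rw [← b.repr_apply_apply, ← b.repr_apply_apply]
  simp [HilbertBasis.diagonal]

theorem HilbertBasis.norm_diagonal_apply_le (b : HilbertBasis ι 𝕜 H) (m : ι → ℝ) (C : ℝ≥0)
    (hm : ∀ i, |m i| ≤ C) (x : H) : ‖b.diagonal m C hm x‖ ≤ C * ‖x‖ := by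
  refine abs_le_of_sq_le_sq' ?_ (by positivity) |>.2
  rw [mul_pow]
  refine hasSum_le (fun i => ?_) (b.hasSum_norm_inner_sq _)
    ((b.hasSum_norm_inner_sq x).mul_left _)
  rw [b.inner_diagonal, norm_mul, mul_pow, RCLike.norm_ofReal]
  gcongr
  exact hm i

theorem abs_exp_neg_mul_le_one {l : ℝ} (hl : 0 ≤ l) (t : ℝ≥0) : |Real.exp (-(t * l))| ≤ (1 : ℝ≥0) := by
  rw [abs_of_pos (Real.exp_pos _), NNReal.coe_one, Real.exp_le_one_iff]
  have := t.2
  have : 0 ≤ (t : ℝ) * l := by positivity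
  linarith

/-- The contraction semigroup `exp (-t λ)` for a nonnegative diagonal operator `λ`. -/
noncomputable def HilbertBasis.diagonalSemigroup (b : HilbertBasis ι 𝕜 H) (l : ι → ℝ)
    (hl : ∀ i, 0 ≤ l i) : C0Semigroup 𝕜 H where
  op t := b.diagonal (fun i => Real.exp (-(t * l i))) 1 fun i => abs_exp_neg_mul_le_one (hl i) t
  op_zero := by
    ext x
    refine b.ext_inner fun i => ?_
    simp [b.inner_diagonal]
  op_add s t := by
    ext x
    refine b.ext_inner fun i => ?_
    simp only [ContinuousLinearMap.comp_apply, b.inner_diagonal, ← mul_assoc, ← RCLike.ofReal_mul,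
      ← Real.exp_add]
    congr 3
    push_cast
    ring
  continuous_orbit x := by
    rw [continuous_iff_continuousAt]
    intro t
    refine b.tendsto_of_tendsto_inner x (Eventually.of_forall fun s i => ?_) fun i => ?_
    · rw [b.inner_diagonal, norm_mul, RCLike.norm_ofReal]
      exact mul_le_of_le_one_left (norm_nonneg _) (abs_exp_neg_mul_le_one (hl i) s)
    · simp only [b.inner_diagonal]
      refine Continuous.tendsto ?_ t
      refine Continuous.mul (RCLike.continuous_ofReal.comp ?_) continuous_const
      fun_prop

variable (b : HilbertBasis ι 𝕜 H) (l : ι → ℝ)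

theorem tendsto_exp_neg_sub_one_div (l : ℝ) :
    Tendsto (fun t : ℝ≥0 => (t : ℝ)⁻¹ * (Real.exp (-(t * l)) - 1)) (𝓝[>] 0) (𝓝 (-l)) := by
  have h : HasDerivAt (fun t : ℝ => Real.exp (-(t * l))) (-l) 0 := by
    have := (((hasDerivAt_id (0 : ℝ)).mul_const l).neg).exp
    simpa using this
  have h2 := h.hasDerivWithinAt (s := Ioi 0)
  rw [hasDerivWithinAt_iff_tendsto_slope' (by simp)] at h2
  have h3 : Tendsto (fun t : ℝ≥0 => (t : ℝ)) (𝓝[>] 0) (𝓝[>] 0) := by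
    refine tendsto_nhdsWithin_iff.2 ⟨?_, ?_⟩
    · exact (NNReal.continuous_coe.tendsto' 0 0 rfl).mono_left nhdsWithin_le_nhds
    · filter_upwards [self_mem_nhdsWithin] with t ht
      exact NNReal.coe_pos.2 ht
  refine (h2.comp h3).congr fun t => ?_
  simp [slope_def_field, div_eq_inv_mul]

/-- A linear operator that is (maximally) diagonal with respect to a Hilbert basis, with
nonpositive entries, generates the corresponding diagonal semigroup. -/
theorem HilbertBasis.diagonalSemigroup_isGeneratedBy (hl : ∀ i, 0 ≤ l i) {A : H →ₗ.[𝕜] H}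
    (hA : ∀ v w, (∃ h : v ∈ A.domain, A ⟨v, h⟩ = w) ↔
      ∀ i, inner 𝕜 (b i) w = -(l i : 𝕜) * inner 𝕜 (b i) v) :
    (b.diagonalSemigroup l hl).IsGeneratedBy A := by
  intro v w
  rw [hA]
  have e : ∀ (t : ℝ≥0) i, inner 𝕜 (b i) ((((t : ℝ) : 𝕜))⁻¹ •
      ((b.diagonalSemigroup l hl).op t v - v)) =
      (((t : ℝ)⁻¹ * (Real.exp (-(t * l i)) - 1) : ℝ) : 𝕜) * inner 𝕜 (b i) v := by
    intro t i
    rw [inner_smul_right, inner_sub_right, HilbertBasis.diagonalSemigroup, b.inner_diagonal]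
    push_cast
    ring
  have lim : ∀ i, Tendsto (fun t : ℝ≥0 => inner 𝕜 (b i) ((((t : ℝ) : 𝕜))⁻¹ •
      ((b.diagonalSemigroup l hl).op t v - v))) (𝓝[>] 0)
      (𝓝 (-(l i : 𝕜) * inner 𝕜 (b i) v)) := by
    intro i
    simp only [e]
    have := (RCLike.continuous_ofReal (K := 𝕜)).tendsto _ |>.comp (tendsto_exp_neg_sub_one_div (l i))
    simpa using this.mul_const (inner 𝕜 (b i) v)
  constructor
  · intro h
    -- The coordinates of `w` dominate those of the difference quotient, because `|exp (-s) - 1| ≤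
    -- s` for `s ≥ 0`.
    refine b.tendsto_of_tendsto_inner w ?_ fun i => (h i).symm ▸ lim i
    filter_upwards [self_mem_nhdsWithin] with t ht i
    have ht' : 0 < (t : ℝ) := NNReal.coe_pos.2 ht
    rw [e, h i, norm_mul, norm_mul, norm_neg, RCLike.norm_ofReal, RCLike.norm_ofReal]
    refine mul_le_mul_of_nonneg_right ?_ (norm_nonneg _)
    rw [abs_mul, abs_of_pos (inv_pos.2 ht'), abs_of_nonneg (hl i), inv_mul_le_iff₀ ht', abs_le]
    have h1 := Real.add_one_le_exp (-(t * l i))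
    have h2 := (le_abs_self _).trans (abs_exp_neg_mul_le_one (hl i) t)
    rw [NNReal.coe_one] at h2
    have h3 : 0 ≤ (t : ℝ) * l i := mul_nonneg ht'.le (hl i)
    constructor <;> linarith
  · intro h i
    exact tendsto_nhds_unique (((innerSL 𝕜 (b i)).continuous.tendsto w).comp h) (lim i)

/-- The function `exp (x r) • f x` has right derivative zero, hence is constant. Only right
derivatives are assumed, because the definition of the generator is a limit at `0` from the right.
-/
theorem eq_exp_smul_of_hasDerivWithinAt_right {E : Type*} [NormedAddCommGroup E] [NormedSpace ℝ E]
    {f : ℝ → E} {r t : ℝ} (ht : 0 ≤ t) (hfc : Continuous f)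
    (hfd : ∀ x ∈ Ico (0 : ℝ) t, HasDerivWithinAt f ((-r) • f x) (Ici x) x) :
    f t = Real.exp (-(t * r)) • f 0 := by
  have hg : ∀ x ∈ Icc (0 : ℝ) t, Real.exp (x * r) • f x = Real.exp (0 * r) • f 0 := by
    refine constant_of_has_deriv_right_zero (by fun_prop) fun x hx => ?_
    have h1 : HasDerivWithinAt (fun y : ℝ => Real.exp (y * r)) (Real.exp (x * r) * r) (Ici x) x := by
      have := ((hasDerivAt_id x).mul_const r).exp.hasDerivWithinAt (s := Ici x)
      simpa using this
    have h2 := h1.smul (hfd x hx)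
    have h0 : Real.exp (x * r) • -r • f x + (Real.exp (x * r) * r) • f x = 0 := by
      rw [smul_smul, ← add_smul]
      simp
    rw [h0] at h2
    exact h2
  have h3 := hg t ⟨ht, le_rfl⟩
  rw [zero_mul, Real.exp_zero, one_smul] at h3
  rw [Real.exp_neg, ← h3, inv_smul_smul₀ (Real.exp_pos _).ne']

/-- A `C₀`-semigroup acts on an eigenvector of its generator by the exponential function. -/
theorem C0Semigroup.IsGeneratedBy.op_eigenvector {T : C0Semigroup 𝕜 H} {A : H →ₗ.[𝕜] H}
    (hT : T.IsGeneratedBy A) {v : H} (hv : v ∈ A.domain) {r : ℝ} (h : A ⟨v, hv⟩ = -(r : 𝕜) • v)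
    (t : ℝ≥0) : T.op t v = (Real.exp (-(t * r)) : 𝕜) • v := by
  let _ : NormedSpace ℝ H := NormedSpace.restrictScalars ℝ 𝕜 H
  have hsm : ∀ (c : ℝ) (x : H), c • x = (c : 𝕜) • x := fun c x => by
    rw [RCLike.real_smul_eq_coe_smul (K := 𝕜)]
  have lim := (hT v _).1 ⟨hv, h⟩
  set f : ℝ → H := fun s => T.op s.toNNReal v with hf
  have hfc : Continuous f := (T.continuous_orbit v).comp continuous_real_toNNReal
  have hfd : ∀ x ∈ Ico (0 : ℝ) t, HasDerivWithinAt f ((-r) • f x) (Ici x) x := by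
    intro x hx
    rw [← hasDerivWithinAt_Ioi_iff_Ici, hasDerivWithinAt_iff_tendsto_slope' (by simp)]
    have l1 : Tendsto (fun y : ℝ => (y - x).toNNReal) (𝓝[>] x) (𝓝[>] 0) := by
      refine tendsto_nhdsWithin_iff.2 ⟨?_, ?_⟩
      · refine Tendsto.mono_left ?_ nhdsWithin_le_nhds
        exact Continuous.tendsto' (by fun_prop) _ _ (by simp)
      · filter_upwards [self_mem_nhdsWithin] with y hy
        simpa using hy
    -- By the semigroup law, the right difference quotient of the orbit at `x` is `T x` applied to
    -- the quotient at `0`.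
    have l2 := ((T.op x.toNNReal).continuous.tendsto _).comp (lim.comp l1)
    have e1 : (T.op x.toNNReal) (-(r : 𝕜) • v) = (-r) • f x := by
      rw [map_smul, hsm]
      simp [hf]
    rw [e1] at l2
    refine l2.congr' ?_
    filter_upwards [self_mem_nhdsWithin] with y hy
    have hy' : x < y := hy
    have e2 : y.toNNReal = x.toNNReal + (y - x).toNNReal := by
      rw [← Real.toNNReal_add hx.1 (by linarith)]
      congr 1
      ring
    simp only [Function.comp_apply, slope_def_module, hsm, hf]
    rw [e2, T.op_add, ContinuousLinearMap.comp_apply, map_smul, map_sub,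
      Real.coe_toNNReal _ (by linarith)]
    simp
  have h3 := eq_exp_smul_of_hasDerivWithinAt_right t.2 hfc hfd
  simp only [hf, NNReal.val_eq_coe, Real.toNNReal_coe, Real.toNNReal_zero, T.op_zero,
    ContinuousLinearMap.id_apply] at h3
  rw [h3, hsm]

theorem HilbertBasis.ext_continuousLinearMap (b : HilbertBasis ι 𝕜 H) {F : Type*}
    [NormedAddCommGroup F] [NormedSpace 𝕜 F] {S T : H →L[𝕜] F} (h : ∀ i, S (b i) = T (b i)) :
    S = T := by
  refine ContinuousLinearMap.ext_on (s := range b) ?_ ?_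
  · rw [Submodule.dense_iff_topologicalClosure_eq_top]
    exact b.dense_span
  · rintro _ ⟨i, rfl⟩
    exact h i

theorem C0Semigroup.ext_op {T S : C0Semigroup 𝕜 H} (h : ∀ t, T.op t = S.op t) : T = S := by
  obtain ⟨_, _, _, _⟩ := T
  obtain ⟨_, _, _, _⟩ := S
  congr
  exact funext h

/-- Each basis vector is an eigenvector of `A`, so every semigroup generated by `A` is determined on
it. A bounded operator is determined by its values on the basis. -/
theorem HilbertBasis.eq_diagonalSemigroup (hl : ∀ i, 0 ≤ l i) {A : H →ₗ.[𝕜] H}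
    (hA : ∀ v w, (∃ h : v ∈ A.domain, A ⟨v, h⟩ = w) ↔
      ∀ i, inner 𝕜 (b i) w = -(l i : 𝕜) * inner 𝕜 (b i) v)
    {T : C0Semigroup 𝕜 H} (hT : T.IsGeneratedBy A) : T = b.diagonalSemigroup l hl := by
  refine C0Semigroup.ext_op fun t => b.ext_continuousLinearMap fun j => ?_
  obtain ⟨hv, hw⟩ := (hA (b j) (-(l j : 𝕜) • b j)).2 fun i => by
    classical
    rw [inner_smul_right, orthonormal_iff_ite.1 b.orthonormal i j]
    split_ifs with h
    · rw [h]
    · simp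
  rw [hT.op_eigenvector hv hw, (b.diagonalSemigroup_isGeneratedBy l hl hA).op_eigenvector hv hw]

end DiagonalOperators

/-! ### Spectral theorem for compact symmetric operators, in Hilbert basis form -/

section Eigenbasis

universe u v w

variable {𝕜 : Type u} {H : Type v} [RCLike 𝕜] [NormedAddCommGroup H] [InnerProductSpace 𝕜 H] [CompleteSpace H]

/-- Hilbert bases of the individual subspaces are glued into one. The union is orthonormal by
orthogonality of the family, and complete because the subspaces together have trivial orthogonal
complement. -/
theorem OrthogonalFamily.exists_hilbertBasis {κ : Type w} {V : κ → Submodule 𝕜 H}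
    [∀ m, CompleteSpace (V m)] (hV : OrthogonalFamily 𝕜 (fun m => V m) fun m => (V m).subtypeₗᵢ)
    (hbot : (⨆ m, V m)ᗮ = ⊥) :
    ∃ (ι : Type (max w v)) (b : HilbertBasis ι 𝕜 H), ∀ i, ∃ m, b i ∈ V m := by
  choose s e he using fun m => _root_.exists_hilbertBasis 𝕜 (V m)
  have ho := hV.orthonormal_sigma_orthonormal fun m => (e m).orthonormal
  refine ⟨_, HilbertBasis.mkOfOrthogonalEqBot ho ?_, fun a => ⟨a.1, ?_⟩⟩
  · rw [← hbot]
    refine le_antisymm (fun x hx => ?_) (Submodule.orthogonal_le (Submodule.span_le.2 ?_))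
    · rw [← Submodule.iInf_orthogonal, Submodule.mem_iInf]
      intro m y hy
      have hz : (innerSL 𝕜 x).comp (V m).subtypeL = 0 := by
        refine (e m).ext_continuousLinearMap fun j => ?_
        exact (Submodule.mem_orthogonal' _ _).1 hx _ (Submodule.subset_span ⟨⟨m, j⟩, rfl⟩)
      have := DFunLike.congr_fun hz ⟨y, hy⟩
      exact inner_eq_zero_symm.1 this
    · rintro _ ⟨a, rfl⟩
      exact Submodule.mem_iSup_of_mem a.1 (e a.1 a.2).2
  · rw [HilbertBasis.coe_mkOfOrthogonalEqBot]
    exact (e a.1 a.2).2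

/-- A compact symmetric operator on a Hilbert space has a Hilbert basis of eigenvectors, and the
eigenvalues are real. -/
theorem IsCompactOperator.exists_hilbertBasis_eigenvectors {R : H →L[𝕜] H}
    (hc : IsCompactOperator R) (hs : (R : H →ₗ[𝕜] H).IsSymmetric) :
    ∃ (ι : Type (max u v)) (b : HilbertBasis ι 𝕜 H) (μ : ι → ℝ), ∀ i, R (b i) = (μ i : 𝕜) • b i := by
  have hcomplete : ∀ m : 𝕜, CompleteSpace (Module.End.eigenspace (R : H →ₗ[𝕜] H) m) := fun m => by
    have : IsClosed ((Module.End.eigenspace (R : H →ₗ[𝕜] H) m : Submodule 𝕜 H) : Set H) := by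
      have : ((Module.End.eigenspace (R : H →ₗ[𝕜] H) m : Submodule 𝕜 H) : Set H) =
          {x | R x = m • x} := by
        ext x
        exact Module.End.mem_eigenspace_iff
      rw [this]
      exact isClosed_eq R.continuous (continuous_const_smul m)
    exact this.completeSpace_coe
  obtain ⟨ι, b, hb⟩ := hs.orthogonalFamily_eigenspaces.exists_hilbertBasis
    (ContinuousLinearMap.orthogonalComplement_iSup_eigenspaces_eq_bot hc hs)
  choose m hm using hb
  refine ⟨ι, b, fun i => RCLike.re (m i), fun i => ?_⟩
  have h2 : ((RCLike.re (m i) : ℝ) : 𝕜) = m i :=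
    RCLike.conj_eq_iff_re.1 (hs.conj_eigenvalue_eq_self
      (Module.End.hasEigenvalue_of_hasEigenvector ⟨hm i, b.orthonormal.ne_zero i⟩))
  rw [h2]
  exact Module.End.mem_eigenspace_iff.1 (hm i)

end Eigenbasis

/-! ### The Green operator: bounds and symmetry -/

section UnitInterval

instance : IsProbabilityMeasure unitIntervalMeasure := ⟨by simp⟩

theorem ae_mem_Ioo_unitIntervalMeasure : ∀ᵐ x ∂unitIntervalMeasure, x ∈ Ioo (0 : ℝ) 1 :=
  ae_restrict_mem measurableSet_Ioo

variable {𝕜 : Type*} [RCLike 𝕜]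

theorem L2UnitInterval.integrable (f : L2UnitInterval 𝕜) : Integrable f unitIntervalMeasure :=
  (Lp.memLp f).integrable (by norm_num)

theorem L2UnitInterval.integral_norm_le (f : L2UnitInterval 𝕜) :
    ∫ x in Ioo (0 : ℝ) 1, ‖f x‖ ≤ ‖f‖ := by
  rw [integral_norm_eq_lintegral_enorm (Lp.aestronglyMeasurable f), ← eLpNorm_one_eq_lintegral_enorm,
    Lp.norm_def]
  exact ENNReal.toReal_mono (Lp.eLpNorm_ne_top f)
    (eLpNorm_le_eLpNorm_of_exponent_le (by norm_num) (Lp.aestronglyMeasurable f))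

theorem L2UnitInterval.norm_le_of_ae_bound {f : L2UnitInterval 𝕜} {C : ℝ} (hC : 0 ≤ C)
    (h : ∀ᵐ x ∂unitIntervalMeasure, ‖f x‖ ≤ C) : ‖f‖ ≤ C := by
  have h1 : measureUnivNNReal unitIntervalMeasure = 1 := by simp [measureUnivNNReal]
  simpa [h1] using Lp.norm_le_of_ae_bound hC h

/-- Fubini for a bounded real kernel on the unit square. -/
theorem integral_mul_integral_kernel_swap {g h : ℝ → 𝕜} {K : ℝ → ℝ → ℝ}
    (hg : Integrable g unitIntervalMeasure) (hh : Integrable h unitIntervalMeasure)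
    (hK : Measurable (Function.uncurry K))
    (hb : ∀ x ∈ Ioo (0 : ℝ) 1, ∀ y ∈ Ioo (0 : ℝ) 1, |K x y| ≤ 1) :
    ∫ x in Ioo (0 : ℝ) 1, h x * ∫ y in Ioo (0 : ℝ) 1, K x y • g y =
      ∫ y in Ioo (0 : ℝ) 1, (∫ x in Ioo (0 : ℝ) 1, K x y • h x) * g y := by
  have hi : Integrable (Function.uncurry fun x y => K x y • (h x * g y))
      (unitIntervalMeasure.prod unitIntervalMeasure) := by
    refine (hh.mul_prod hg).bdd_smul 1 hK.aestronglyMeasurable ?_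
    have h1 := Measure.ae_prod_mem_iff_ae_ae_mem (μ := unitIntervalMeasure)
      (ν := unitIntervalMeasure) (s := Ioo (0 : ℝ) 1 ×ˢ Ioo (0 : ℝ) 1)
      (measurableSet_Ioo.prod measurableSet_Ioo)
    have h2 : ∀ᵐ z ∂(unitIntervalMeasure.prod unitIntervalMeasure),
        z ∈ Ioo (0 : ℝ) 1 ×ˢ Ioo (0 : ℝ) 1 := by
      rw [h1]
      filter_upwards [ae_mem_Ioo_unitIntervalMeasure] with x hx
      filter_upwards [ae_mem_Ioo_unitIntervalMeasure] with y hy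
      exact ⟨hx, hy⟩
    filter_upwards [h2] with z hz
    exact hb z.1 hz.1 z.2 hz.2
  simp_rw [← integral_const_mul, ← integral_mul_const, mul_smul_comm, smul_mul_assoc]
  exact integral_integral_swap hi

theorem integral_ite_lt_smul (g : ℝ → 𝕜) {s : ℝ} (hs : s ∈ Icc (0 : ℝ) 1) :
    ∫ y in Ioo (0 : ℝ) 1, (if y < s then (1 : ℝ) else 0) • g y = ∫ y in 0..s, g y := by
  have h1 : ∀ y, (if y < s then (1 : ℝ) else 0) • g y = (Iio s).indicator g y := by
    intro y
    by_cases h : y < s <;> simp [h, indicator]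
  simp_rw [h1]
  rw [setIntegral_indicator measurableSet_Iio, intervalIntegral.integral_of_le hs.1,
    integral_Ioc_eq_integral_Ioo]
  congr 2
  ext y
  simp only [mem_inter_iff, mem_Ioo, mem_Iio]
  constructor
  · rintro ⟨⟨h1, _⟩, h2⟩
    exact ⟨h1, h2⟩
  · rintro ⟨h1, h2⟩
    exact ⟨⟨h1, h2.trans_le hs.2⟩, h2⟩

/-- The kernel `(1 - |x - y|) / 2`, the Green function of the Laplacian with the boundary
conditions `v'(0) = -v'(1) = v(0) + v(1)`. -/
noncomputable def greenKernel (x y : ℝ) : ℝ := (1 - |x - y|) / 2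

theorem measurable_greenKernel : Measurable (Function.uncurry greenKernel) := by
  unfold greenKernel Function.uncurry
  fun_prop

theorem continuous_greenKernel (x : ℝ) : Continuous (greenKernel x) := by
  unfold greenKernel
  fun_prop

theorem abs_greenKernel_le {x y : ℝ} (hx : x ∈ Icc (0 : ℝ) 1) (hy : y ∈ Icc (0 : ℝ) 1) :
    |greenKernel x y| ≤ 1 / 2 := by
  have h : |x - y| ≤ 1 := abs_le.2 ⟨by linarith [hx.1, hy.2], by linarith [hx.2, hy.1]⟩
  unfold greenKernel
  rw [abs_le]
  constructor <;> linarith [abs_nonneg (x - y)]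

theorem abs_greenKernel_sub_le (x x' y : ℝ) :
    |greenKernel x y - greenKernel x' y| ≤ |x - x'| / 2 := by
  unfold greenKernel
  have h := abs_abs_sub_abs_le (x' - y) (x - y)
  rw [sub_sub_sub_cancel_right, abs_sub_comm x' x] at h
  rw [show (1 - |x - y|) / 2 - (1 - |x' - y|) / 2 = (|x' - y| - |x - y|) / 2 by ring, abs_div]
  simpa using div_le_div_of_nonneg_right h zero_le_two

/-- The integral operator with kernel `greenKernel`. -/
noncomputable def greenFun (f : ℝ → 𝕜) (x : ℝ) : 𝕜 := ∫ y in Ioo (0 : ℝ) 1, greenKernel x y • f y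

variable {f g : ℝ → 𝕜}

theorem integrable_greenKernel_smul (hf : Integrable f unitIntervalMeasure) (x : ℝ) :
    Integrable (fun y => greenKernel x y • f y) unitIntervalMeasure := by
  refine hf.bdd_smul (greenKernel x x + |x| + 1)
    (continuous_greenKernel x).aestronglyMeasurable ?_
  filter_upwards [ae_mem_Ioo_unitIntervalMeasure] with y hy
  rw [Real.norm_eq_abs]
  unfold greenKernel
  have h1 : |x - y| ≤ |x| + |y| := abs_sub _ _
  rw [abs_of_pos hy.1] at h1
  rw [abs_le]
  constructor <;> simp <;> linarith [hy.2, hy.1, abs_nonneg (x - y), abs_nonneg x]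

theorem greenFun_congr (h : f =ᵐ[unitIntervalMeasure] g) : greenFun f = greenFun g := by
  ext x
  refine integral_congr_ae ?_
  filter_upwards [h] with y hy
  rw [hy]

theorem greenFun_add (hf : Integrable f unitIntervalMeasure) (hg : Integrable g unitIntervalMeasure)
    (x : ℝ) : greenFun (f + g) x = greenFun f x + greenFun g x := by
  simp only [greenFun, Pi.add_apply, smul_add]
  exact integral_add (integrable_greenKernel_smul hf x) (integrable_greenKernel_smul hg x)

theorem greenFun_smul (c : 𝕜) (x : ℝ) : greenFun (c • f) x = c • greenFun f x := by
  simp only [greenFun, Pi.smul_apply]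
  rw [← integral_smul]
  simp_rw [smul_comm c]

theorem greenFun_conj (x : ℝ) : greenFun (star f) x = star (greenFun f x) := by
  simp only [greenFun, Pi.star_apply, RCLike.star_def]
  rw [← integral_conj]
  simp [RCLike.real_smul_eq_coe_mul]

/-- This `L¹ → L^∞` bound is the smoothing property that later turns spectral decay into pointwise
decay. -/
theorem norm_greenFun_le (hf : Integrable f unitIntervalMeasure) {x : ℝ} (hx : x ∈ Icc (0 : ℝ) 1) :
    ‖greenFun f x‖ ≤ (∫ y in Ioo (0 : ℝ) 1, ‖f y‖) / 2 := by
  rw [div_eq_inv_mul, ← integral_const_mul]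
  refine norm_integral_le_of_norm_le (hf.norm.const_mul _) ?_
  filter_upwards [ae_mem_Ioo_unitIntervalMeasure] with y hy
  rw [norm_smul, Real.norm_eq_abs]
  gcongr
  exact (abs_greenKernel_le hx (Ioo_subset_Icc_self hy)).trans_eq (by norm_num)

theorem norm_greenFun_sub_le (hf : Integrable f unitIntervalMeasure) (x x' : ℝ) :
    ‖greenFun f x - greenFun f x'‖ ≤ |x - x'| / 2 * ∫ y in Ioo (0 : ℝ) 1, ‖f y‖ := by
  unfold greenFun
  rw [← integral_sub (integrable_greenKernel_smul hf x) (integrable_greenKernel_smul hf x'),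
    ← integral_const_mul]
  refine norm_integral_le_of_norm_le (hf.norm.const_mul _) (Eventually.of_forall fun y => ?_)
  rw [← sub_smul, norm_smul, Real.norm_eq_abs]
  gcongr
  exact abs_greenKernel_sub_le x x' y

theorem continuous_greenFun (hf : Integrable f unitIntervalMeasure) : Continuous (greenFun f) := by
  have h0 : 0 ≤ ∫ y in Ioo (0 : ℝ) 1, ‖f y‖ := integral_nonneg fun _ => norm_nonneg _
  refine (LipschitzWith.of_dist_le_mul (K := (∫ y in Ioo (0 : ℝ) 1, ‖f y‖).toNNReal)
    fun x x' => ?_).continuous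
  rw [dist_eq_norm, Real.dist_eq, Real.coe_toNNReal _ h0]
  refine (norm_greenFun_sub_le hf x x').trans ?_
  nlinarith [abs_nonneg (x - x')]

theorem memLp_two_of_bound_Icc {F : ℝ → 𝕜} (hF : AEStronglyMeasurable F unitIntervalMeasure) (C : ℝ)
    (h : ∀ x ∈ Icc (0 : ℝ) 1, ‖F x‖ ≤ C) : MemLp F 2 unitIntervalMeasure := by
  refine MemLp.of_bound hF C ?_
  filter_upwards [ae_mem_Ioo_unitIntervalMeasure] with x hx
  exact h x (Ioo_subset_Icc_self hx)

theorem ContinuousOn.memLp_unitIntervalMeasure {F : ℝ → 𝕜} (hF : ContinuousOn F (Icc 0 1)) :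
    MemLp F 2 unitIntervalMeasure := by
  obtain ⟨C, hC⟩ := isCompact_Icc.exists_bound_of_continuousOn hF
  exact memLp_two_of_bound_Icc
    ((hF.mono Ioo_subset_Icc_self).aestronglyMeasurable measurableSet_Ioo) C hC

theorem memLp_greenFun (hf : Integrable f unitIntervalMeasure) :
    MemLp (greenFun f) 2 unitIntervalMeasure :=
  (continuous_greenFun hf).continuousOn.memLp_unitIntervalMeasure

variable (𝕜) in
/-- The integral operator with kernel `greenKernel`, as a bounded operator on `L²(0,1)`. -/
noncomputable def greenOp : L2UnitInterval 𝕜 →L[𝕜] L2UnitInterval 𝕜 :=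
  LinearMap.mkContinuous
    { toFun := fun f => (memLp_greenFun f.integrable).toLp (greenFun f)
      map_add' := fun f g => by
        rw [← MemLp.toLp_add]
        refine MemLp.toLp_congr _ _ (Eventually.of_forall fun x => ?_)
        rw [greenFun_congr (Lp.coeFn_add f g), greenFun_add f.integrable g.integrable]
        rfl
      map_smul' := fun c f => by
        rw [RingHom.id_apply, ← MemLp.toLp_const_smul]
        refine MemLp.toLp_congr _ _ (Eventually.of_forall fun x => ?_)
        rw [greenFun_congr (Lp.coeFn_smul c f), greenFun_smul]
        rfl } (1 / 2) fun f => by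
    refine L2UnitInterval.norm_le_of_ae_bound (by positivity) ?_
    rw [LinearMap.coe_mk, AddHom.coe_mk]
    filter_upwards [(memLp_greenFun f.integrable).coeFn_toLp, ae_mem_Ioo_unitIntervalMeasure]
      with x hx hx'
    rw [hx]
    refine (norm_greenFun_le f.integrable (Ioo_subset_Icc_self hx')).trans ?_
    linarith [f.integral_norm_le]

theorem coeFn_greenOp (f : L2UnitInterval 𝕜) : greenOp 𝕜 f =ᵐ[unitIntervalMeasure] greenFun f :=
  (memLp_greenFun f.integrable).coeFn_toLp

theorem norm_greenOp_apply_le (f : L2UnitInterval 𝕜) :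
    ‖greenOp 𝕜 f‖ ≤ (∫ y in Ioo (0 : ℝ) 1, ‖f y‖) / 2 := by
  have h0 : 0 ≤ ∫ y in Ioo (0 : ℝ) 1, ‖f y‖ := integral_nonneg fun _ => norm_nonneg _
  refine L2UnitInterval.norm_le_of_ae_bound (by positivity) ?_
  filter_upwards [coeFn_greenOp f, ae_mem_Ioo_unitIntervalMeasure] with x hx hx'
  rw [hx]
  exact norm_greenFun_le f.integrable (Ioo_subset_Icc_self hx')

/-- Fubini, together with the symmetry and the reality of the kernel; conjugation is first moved
inside the integral operator. -/
theorem greenOp_isSymmetric : (greenOp 𝕜 : L2UnitInterval 𝕜 →ₗ[𝕜] L2UnitInterval 𝕜).IsSymmetric := by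
  intro f g
  rw [L2.inner_def, L2.inner_def]
  have h1 : ∫ x in Ioo (0 : ℝ) 1, inner 𝕜 (greenOp 𝕜 f x) (g x) =
      ∫ x in Ioo (0 : ℝ) 1, g x * ∫ y in Ioo (0 : ℝ) 1, greenKernel x y • (star f) y := by
    refine integral_congr_ae ?_
    filter_upwards [coeFn_greenOp f] with x hx
    rw [hx, RCLike.inner_apply, ← RCLike.star_def, ← greenFun_conj,
      ← greenFun_congr (Lp.coeFn_star f)]
    rfl
  have h2 : ∫ x in Ioo (0 : ℝ) 1, inner 𝕜 (f x) (greenOp 𝕜 g x) =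
      ∫ y in Ioo (0 : ℝ) 1, (∫ x in Ioo (0 : ℝ) 1, greenKernel x y • g x) * (star f) y := by
    refine integral_congr_ae ?_
    filter_upwards [coeFn_greenOp g, Lp.coeFn_star f] with x hx h3
    rw [hx, RCLike.inner_apply, h3]
    simp only [greenFun, greenKernel, abs_sub_comm x]
    rfl
  refine h1.trans (Eq.trans ?_ h2.symm)
  refine integral_mul_integral_kernel_swap (star f).integrable g.integrable
    measurable_greenKernel fun x hx y hy => ?_
  linarith [abs_greenKernel_le (Ioo_subset_Icc_self hx) (Ioo_subset_Icc_self hy)]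

/-! ### Compactness of the Green operator -/

section Compactness

theorem memLp_stepFunction (n : ℕ) (c : Fin (n + 1) → 𝕜) :
    MemLp (fun x : ℝ => c (Fin.ofNat (n + 1) ⌊(n + 1) * x⌋₊)) 2 unitIntervalMeasure :=
  memLp_two_of_bound_Icc
    ((measurable_from_top (f := fun k : ℕ => c (Fin.ofNat (n + 1) k))).comp
      (by fun_prop : Measurable fun x : ℝ => ⌊(n + 1) * x⌋₊)).aestronglyMeasurable
    ‖c‖ fun _ _ => norm_le_pi_norm c _

variable (𝕜) in
/-- Step functions on the uniform partition of `(0,1)` into `n + 1` intervals. -/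
noncomputable def stepFunctionLp (n : ℕ) : (Fin (n + 1) → 𝕜) →ₗ[𝕜] L2UnitInterval 𝕜 :=
  { toFun := fun c => (memLp_stepFunction n c).toLp _
    map_add' := fun _ _ => rfl
    map_smul' := fun _ _ => rfl }

theorem coeFn_stepFunctionLp (n : ℕ) (c : Fin (n + 1) → 𝕜) :
    stepFunctionLp 𝕜 n c =ᵐ[unitIntervalMeasure]
      fun x : ℝ => c (Fin.ofNat (n + 1) ⌊(n + 1) * x⌋₊) :=
  (memLp_stepFunction n c).coeFn_toLp

variable (𝕜) in
/-- Pointwise evaluation of `greenFun f`, for a point of `[0,1]`. -/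
noncomputable def greenEval {x : ℝ} (hx : x ∈ Icc (0 : ℝ) 1) : L2UnitInterval 𝕜 →L[𝕜] 𝕜 :=
  LinearMap.mkContinuous
    { toFun := fun f => greenFun f x
      map_add' := fun f g => by
        rw [greenFun_congr (Lp.coeFn_add f g), greenFun_add f.integrable g.integrable]
      map_smul' := fun c f => by
        rw [greenFun_congr (Lp.coeFn_smul c f), greenFun_smul, RingHom.id_apply] } (1 / 2) fun f => by
    refine (norm_greenFun_le f.integrable hx).trans ?_
    linarith [f.integral_norm_le]

/-- Sampling `greenFun f` at the left endpoints `k / (n + 1)` and extending by a step function gives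
finite-rank operators. The Lipschitz bound for `greenFun f` makes them converge to `greenOp` in
operator norm, with error at most `1 / (n + 1)`. -/
theorem greenOp_isCompactOperator : IsCompactOperator (greenOp 𝕜) := by
  have hk : ∀ (n : ℕ) (k : Fin (n + 1)), ((k : ℝ) / (n + 1)) ∈ Icc (0 : ℝ) 1 := fun n k => by
    have : (k : ℝ) < n + 1 := by exact_mod_cast k.2
    exact ⟨by positivity, (div_le_one (by positivity)).2 this.le⟩
  set F : ℕ → L2UnitInterval 𝕜 →L[𝕜] L2UnitInterval 𝕜 := fun n =>
    (LinearMap.toContinuousLinearMap (stepFunctionLp 𝕜 n)).comp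
      (ContinuousLinearMap.pi fun k => greenEval 𝕜 (hk n k)) with hF
  have hFc : ∀ n, IsCompactOperator (F n) := fun n =>
    ((isCompactOperator_id_iff_finiteDimensional (𝕜 := 𝕜) (E := Fin (n + 1) → 𝕜)).2
      inferInstance |>.comp_clm (ContinuousLinearMap.pi fun k => greenEval 𝕜 (hk n k))).clm_comp
      (LinearMap.toContinuousLinearMap (stepFunctionLp 𝕜 n))
  refine isCompactOperator_of_tendsto (F := F) (l := atTop) ?_ (Eventually.of_forall hFc)
  rw [tendsto_iff_norm_sub_tendsto_zero]
  refine squeeze_zero (fun _ => norm_nonneg _) (fun n => ?_)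
    (tendsto_one_div_add_atTop_nhds_zero_nat (𝕜 := ℝ))
  refine ContinuousLinearMap.opNorm_le_bound _ (by positivity) fun f => ?_
  refine L2UnitInterval.norm_le_of_ae_bound (by positivity) ?_
  rw [sub_apply]
  filter_upwards [Lp.coeFn_sub (F n f) (greenOp 𝕜 f), coeFn_greenOp f,
    coeFn_stepFunctionLp n (fun k => greenEval 𝕜 (hk n k) f), ae_mem_Ioo_unitIntervalMeasure]
    with x h1 h2 h3 hx
  have hn : (0 : ℝ) < n + 1 := by positivity
  have hx0 : 0 ≤ (n + 1) * x := mul_nonneg hn.le hx.1.le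
  -- Since `x < 1`, the index is in range and the reduction modulo `n + 1` in `Fin.ofNat` has no
  -- effect.
  have hlt : ⌊(n + 1) * x⌋₊ < n + 1 := by
    rw [Nat.floor_lt hx0]
    push_cast
    nlinarith [hx.2]
  have h4 : F n f x = greenFun f ((⌊(n + 1) * x⌋₊ : ℝ) / (n + 1)) := by
    refine Eq.trans h3 ?_
    change greenFun f _ = _
    simp [Nat.mod_eq_of_lt hlt]
  rw [h1, Pi.sub_apply, h2, h4]
  refine (norm_greenFun_sub_le f.integrable _ _).trans ?_
  refine mul_le_mul ?_ f.integral_norm_le (integral_nonneg fun _ => norm_nonneg _) (by positivity)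
  have h5 := Nat.floor_le hx0
  have h6 := Nat.lt_floor_add_one ((n + 1) * x)
  have h7 : |(⌊(n + 1) * x⌋₊ : ℝ) / (n + 1) - x| ≤ 1 / (n + 1) := by
    rw [div_sub' hn.ne', abs_div, abs_of_pos hn]
    gcongr
    rw [abs_le]
    constructor <;> linarith
  linarith [abs_nonneg ((⌊(n + 1) * x⌋₊ : ℝ) / (n + 1) - x)]

end Compactness

end UnitInterval

/-! ### Weak derivatives of primitives, du Bois-Reymond lemma, boundary values -/

section WeakDerivatives

variable {𝕜 : Type*} [RCLike 𝕜]

/-- This is the inner integral that arises when Fubini is applied to a test function derivative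
against a primitive. -/
theorem integral_ite_gt_deriv {φ : ℝ → ℝ} (hφ : ContDiff ℝ ∞ φ) (h1 : φ 1 = 0) {y : ℝ}
    (hy : y ∈ Ico (0 : ℝ) 1) :
    ∫ x in Ioo (0 : ℝ) 1, (if y < x then (1 : ℝ) else 0) • ((deriv φ x : ℝ) : 𝕜) = -(φ y : 𝕜) := by
  have h : ∀ x, (if y < x then (1 : ℝ) else 0) • ((deriv φ x : ℝ) : 𝕜) =
      (Ioi y).indicator (fun x => ((deriv φ x : ℝ) : 𝕜)) x := by
    intro x
    by_cases h : y < x <;> simp [h, indicator]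
  have hs : Ioo (0 : ℝ) 1 ∩ Ioi y = Ioo y 1 := by
    ext x
    simp only [mem_inter_iff, mem_Ioo, mem_Ioi]
    exact ⟨fun h => ⟨h.2, h.1.2⟩, fun h => ⟨⟨hy.1.trans_lt h.1, h.2⟩, h.1⟩⟩
  simp_rw [h]
  rw [setIntegral_indicator measurableSet_Ioi, hs, integral_ofReal, ← integral_Ioc_eq_integral_Ioo,
    ← intervalIntegral.integral_of_le hy.2.le, intervalIntegral.integral_deriv_eq_sub
      (fun x _ => (hφ.differentiable (by simp)).differentiableAt)
      ((hφ.continuous_deriv (by simp)).intervalIntegrable _ _), h1]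
  simp

theorem intervalIntegral_congr_of_ae_unitInterval {g g' : ℝ → 𝕜} (h : g =ᵐ[unitIntervalMeasure] g')
    {x : ℝ} (hx : x ∈ Icc (0 : ℝ) 1) : ∫ y in 0..x, g y = ∫ y in 0..x, g' y := by
  rw [intervalIntegral.integral_of_le hx.1, intervalIntegral.integral_of_le hx.1,
    integral_Ioc_eq_integral_Ioo, integral_Ioc_eq_integral_Ioo]
  exact integral_congr_ae (ae_mono (Measure.restrict_mono (Ioo_subset_Ioo_right hx.2) le_rfl) h)

/-- A primitive of an `L²` function has this function as its weak derivative. -/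
theorem hasWeakDeriv_of_primitive {u w : L2UnitInterval 𝕜} {g : ℝ → 𝕜} (c : 𝕜)
    (hg : w =ᵐ[unitIntervalMeasure] g)
    (hu : ∀ᵐ x ∂unitIntervalMeasure, u x = c + ∫ y in 0..x, g y) : HasWeakDeriv u w := by
  intro φ hφ hc hs
  have hφ0 : φ 0 = 0 := image_eq_zero_of_notMem_tsupport fun h => absurd (hs h).1 (lt_irrefl _)
  have hφ1 : φ 1 = 0 := image_eq_zero_of_notMem_tsupport fun h => absurd (hs h).2 (lt_irrefl _)
  have hφ' : Continuous (deriv φ) := hφ.continuous_deriv (by simp)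
  have hi1 : Integrable (fun x => deriv φ x • c) unitIntervalMeasure :=
    (hφ'.integrable_of_hasCompactSupport hc.deriv).smul_const c |>.integrableOn
  have hi : Integrable (fun x => deriv φ x • u x) unitIntervalMeasure :=
    integrable_contDiff_smul hφ' hc.deriv u
  have hi2 : Integrable (fun x => deriv φ x • (u x - c)) unitIntervalMeasure := by
    simp_rw [smul_sub]
    exact hi.sub hi1
  have e1 : ∫ x in Ioo (0 : ℝ) 1, deriv φ x • c = 0 := by
    rw [integral_smul_const, ← integral_Ioc_eq_integral_Ioo,
      ← intervalIntegral.integral_of_le zero_le_one, intervalIntegral.integral_deriv_eq_sub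
      (fun x _ => (hφ.differentiable (by simp)).differentiableAt)
      (hφ'.intervalIntegrable _ _), hφ0, hφ1]
    simp
  have e2 : ∫ x in Ioo (0 : ℝ) 1, deriv φ x • u x =
      ∫ x in Ioo (0 : ℝ) 1, ((deriv φ x : ℝ) : 𝕜) *
        ∫ y in Ioo (0 : ℝ) 1, (if y < x then (1 : ℝ) else 0) • w y := by
    calc ∫ x in Ioo (0 : ℝ) 1, deriv φ x • u x
        = ∫ x in Ioo (0 : ℝ) 1, (deriv φ x • (u x - c) + deriv φ x • c) := by
          simp_rw [← smul_add, sub_add_cancel]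
      _ = ∫ x in Ioo (0 : ℝ) 1, deriv φ x • (u x - c) := by
          rw [integral_add hi2 hi1, e1, add_zero]
      _ = _ := by
          refine integral_congr_ae ?_
          filter_upwards [hu, ae_mem_Ioo_unitIntervalMeasure] with x hx hx'
          have hx'' := Ioo_subset_Icc_self hx'
          rw [hx, add_sub_cancel_left, integral_ite_lt_smul _ hx'',
            intervalIntegral_congr_of_ae_unitInterval hg hx'', RCLike.real_smul_eq_coe_mul]
  have hi3 : Integrable (fun x => ((deriv φ x : ℝ) : 𝕜)) unitIntervalMeasure :=
    (hφ'.integrable_of_hasCompactSupport hc.deriv).ofReal.integrableOn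
  rw [e2, integral_mul_integral_kernel_swap w.integrable hi3, ← integral_neg]
  · refine integral_congr_ae ?_
    filter_upwards [ae_mem_Ioo_unitIntervalMeasure] with y hy
    rw [integral_ite_gt_deriv hφ hφ1 ⟨hy.1.le, hy.2⟩, RCLike.real_smul_eq_coe_mul, neg_mul]
  · exact Measurable.ite (measurableSet_lt measurable_snd measurable_fst) measurable_const
      measurable_const
  · intro x _ y _
    split_ifs <;> simp

theorem exists_contDiff_integral_eq_one :
    ∃ ρ : ℝ → ℝ, ContDiff ℝ ∞ ρ ∧ HasCompactSupport ρ ∧ tsupport ρ ⊆ Ioo 0 1 ∧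
      ∫ x in Ioo (0 : ℝ) 1, ρ x = 1 := by
  let b : ContDiffBump (1 / 2 : ℝ) := ⟨1 / 8, 1 / 4, by norm_num, by norm_num⟩
  have hs : tsupport (b.normed volume) ⊆ Ioo (0 : ℝ) 1 := by
    rw [b.tsupport_normed_eq, Real.closedBall_eq_Icc]
    intro x hx
    have h4 : b.rOut = 1 / 4 := rfl
    rw [h4] at hx
    exact ⟨by linarith [hx.1], by linarith [hx.2]⟩
  refine ⟨b.normed volume, b.contDiff_normed, b.hasCompactSupport_normed, hs, ?_⟩
  rw [setIntegral_eq_integral_of_forall_compl_eq_zero, b.integral_normed]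
  intro x hx
  exact image_eq_zero_of_notMem_tsupport fun h => hx (hs h)

/-- A test function with vanishing integral is the derivative of a test function. -/
theorem exists_contDiff_deriv_eq {θ : ℝ → ℝ} (hθ : ContDiff ℝ ∞ θ) (hc : HasCompactSupport θ)
    (hs : tsupport θ ⊆ Ioo 0 1) (h0 : ∫ x in Ioo (0 : ℝ) 1, θ x = 0) :
    ∃ φ : ℝ → ℝ, ContDiff ℝ ∞ φ ∧ HasCompactSupport φ ∧ tsupport φ ⊆ Ioo 0 1 ∧ deriv φ = θ := by
  have hd : deriv (fun x => ∫ y in 0..x, θ y) = θ := by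
    ext x
    exact hθ.continuous.deriv_integral θ 0 x
  -- The point `1 / 2` only ensures that the compact set is nonempty, so that it has a least and a
  -- greatest element even if `θ = 0`.
  have hK : IsCompact (tsupport θ ∪ {1 / 2}) := hc.isCompact.union isCompact_singleton
  have hK' : tsupport θ ∪ {1 / 2} ⊆ Ioo (0 : ℝ) 1 := by
    refine union_subset hs ?_
    rintro _ rfl
    norm_num
  have hne : (tsupport θ ∪ {1 / 2}).Nonempty := ⟨1 / 2, Or.inr rfl⟩
  obtain ⟨a, ha, hla⟩ := hK.exists_isLeast hne
  obtain ⟨b, hb, hgb⟩ := hK.exists_isGreatest hne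
  have za : ∀ y < a, θ y = 0 := fun y hy => image_eq_zero_of_notMem_tsupport fun h =>
    absurd (hla (Or.inl h)) hy.not_ge
  have zb : ∀ y, b < y → θ y = 0 := fun y hy => image_eq_zero_of_notMem_tsupport fun h =>
    absurd (hgb (Or.inl h)) hy.not_ge
  have hsupp : tsupport (fun x => ∫ y in 0..x, θ y) ⊆ Icc a b := by
    refine closure_minimal (fun x hx => ?_) isClosed_Icc
    rw [Function.mem_support] at hx
    by_contra hxab
    rw [mem_Icc, not_and_or, not_le, not_le] at hxab
    refine hx ?_
    rcases hxab with h | h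
    · refine intervalIntegral.integral_zero_ae (Eventually.of_forall fun y hy => za y ?_)
      exact (uIoc_subset_uIcc hy).2.trans_lt (max_lt (hK' ha).1 h)
    -- To the right of the support the primitive equals the full integral over `(0,1)`, which
    -- vanishes by `h0`.
    · rw [← intervalIntegral.integral_add_adjacent_intervals
        (hθ.continuous.intervalIntegrable 0 1) (hθ.continuous.intervalIntegrable 1 x),
        intervalIntegral.integral_of_le zero_le_one, integral_Ioc_eq_integral_Ioo, h0, zero_add]
      refine intervalIntegral.integral_zero_ae (Eventually.of_forall fun y hy => zb y ?_)
      exact (lt_min (hK' hb).2 h).trans_le (uIoc_subset_uIcc hy).1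
  refine ⟨fun x => ∫ y in 0..x, θ y, ?_, ?_, hsupp.trans (Icc_subset_Ioo (hK' ha).1 (hK' hb).2), hd⟩
  · rw [contDiff_infty_iff_deriv, hd]
    exact ⟨fun x => (hθ.continuous.integral_hasStrictDerivAt 0 x).hasDerivAt.differentiableAt, hθ⟩
  · exact HasCompactSupport.of_support_subset_isCompact isCompact_Icc
      ((subset_tsupport _).trans hsupp)

/-- The lemma of du Bois-Reymond. -/
theorem HasWeakDeriv.ae_eq_const {u : L2UnitInterval 𝕜} (h : HasWeakDeriv u 0) :
    ∃ c : 𝕜, ∀ᵐ x ∂unitIntervalMeasure, u x = c := by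
  obtain ⟨ρ, hρ, hρc, hρs, hρ1⟩ := exists_contDiff_integral_eq_one
  -- As `ρ` has integral `1`, this is the only possible value of the constant.
  set c : 𝕜 := ∫ x in Ioo (0 : ℝ) 1, ρ x • u x with hcdef
  have key : ∀ᵐ x ∂volume, x ∈ Ioo (0 : ℝ) 1 → u x - c = 0 := by
    refine isOpen_Ioo.ae_eq_zero_of_integral_contDiff_smul_eq_zero
      (IntegrableOn.locallyIntegrableOn ?_) ?_
    · exact u.integrable.sub (integrable_const c)
    intro ψ hψ hψc hψs
    have hψi : Integrable ψ unitIntervalMeasure :=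
      (hψ.continuous.integrable_of_hasCompactSupport hψc).integrableOn
    have hρi : Integrable ρ unitIntervalMeasure :=
      (hρ.continuous.integrable_of_hasCompactSupport hρc).integrableOn
    -- The function `ψ - m ρ` has integral zero, so it is the derivative of a test function and may
    -- be inserted into the hypothesis on `u`.
    set m : ℝ := ∫ x in Ioo (0 : ℝ) 1, ψ x with hm
    have hsub : tsupport (ψ - m • ρ) ⊆ tsupport ψ ∪ tsupport ρ :=
      (tsupport_sub ψ _).trans (union_subset_union_right _ (tsupport_smul_subset_right (fun _ => m) ρ))
    obtain ⟨φ, hφ, hφc, hφs, hφd⟩ := exists_contDiff_deriv_eq (θ := ψ - m • ρ)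
      (hψ.sub (hρ.const_smul m)) (hψc.sub (hρc.smul_left (f := fun _ => m)))
      (hsub.trans (union_subset hψs hρs)) (by
        simp only [Pi.sub_apply, Pi.smul_apply, smul_eq_mul]
        rw [integral_sub hψi (hρi.const_mul m), integral_const_mul, hρ1, mul_one, sub_self])
    have h2 := h φ hφ hφc hφs
    have h3 : ∫ x in Ioo (0 : ℝ) 1, φ x • (0 : L2UnitInterval 𝕜) x = 0 := by simp
    rw [h3, neg_zero, hφd] at h2
    simp only [Pi.sub_apply, Pi.smul_apply, sub_smul, smul_assoc] at h2
    have hψu := integrable_contDiff_smul hψ.continuous hψc u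
    have hρu := integrable_contDiff_smul hρ.continuous hρc u
    have hρm : Integrable (fun x => m • ρ x • u x) unitIntervalMeasure := hρu.smul m
    rw [integral_sub hψu hρm, integral_smul, ← hcdef] at h2
    rw [← setIntegral_eq_integral_of_forall_compl_eq_zero (s := Ioo (0 : ℝ) 1)]
    · simp only [smul_sub]
      rw [integral_sub hψu (hψi.smul_const c), integral_smul_const]
      exact h2
    · intro x hx
      rw [image_eq_zero_of_notMem_tsupport (fun h' => hx (hψs h')), zero_smul]
  refine ⟨c, ?_⟩
  filter_upwards [(ae_restrict_iff' measurableSet_Ioo).2 key] with x hx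
  exact sub_eq_zero.1 hx

/-- Continuous functions that agree almost everywhere on `[0,1]` agree at the endpoints too, so
boundary values can be read off any continuous representative. -/
theorem HasBoundaryValues.eq_of_ae_eq {u : L2UnitInterval 𝕜} {a b : 𝕜} (h : HasBoundaryValues u a b)
    {f : ℝ → 𝕜} (hf : ContinuousOn f (Icc 0 1)) (huf : u =ᵐ[unitIntervalMeasure] f) :
    a = f 0 ∧ b = f 1 := by
  obtain ⟨g, hg, hug, rfl, rfl⟩ := h
  have hfg : g =ᵐ[volume.restrict (Icc (0 : ℝ) 1)] f := by
    rw [← restrict_Ioo_eq_restrict_Icc]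
    exact hug.symm.trans huf
  have := Measure.eqOn_Icc_of_ae_eq volume zero_ne_one hfg hg hf
  exact ⟨this (by simp), this (by simp)⟩

end WeakDerivatives

/-! ### The Green operator inverts the negative Laplacian; self-adjointness -/

section GreenFunction

variable {𝕜 : Type*} [RCLike 𝕜]

/-- The derivative of `greenFun f`. -/
noncomputable def greenDeriv (f : ℝ → 𝕜) (s : ℝ) : 𝕜 :=
  (1 / 2 : ℝ) • (∫ y in Ioo (0 : ℝ) 1, f y) - ∫ y in 0..s, f y

variable {f : ℝ → 𝕜}

theorem continuousOn_greenDeriv (hf : Integrable f unitIntervalMeasure) :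
    ContinuousOn (greenDeriv f) (Icc 0 1) := by
  refine continuousOn_const.sub ?_
  have := intervalIntegral.continuousOn_primitive_interval (f := f) (a := 0) (b := 1) (μ := volume)
    (by rw [uIcc_of_le zero_le_one, integrableOn_Icc_iff_integrableOn_Ioo]; exact hf)
  rwa [uIcc_of_le zero_le_one] at this

theorem greenDeriv_zero : greenDeriv f 0 = (1 / 2 : ℝ) • ∫ y in Ioo (0 : ℝ) 1, f y := by
  simp [greenDeriv]

theorem greenDeriv_one : greenDeriv f 1 = -greenDeriv f 0 := by
  rw [greenDeriv_zero, greenDeriv, intervalIntegral.integral_of_le zero_le_one,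
    integral_Ioc_eq_integral_Ioo]
  module

/-- For `y` in `(0,1)`, `greenKernel 0 y + greenKernel 1 y = (1 - y) / 2 + y / 2 = 1 / 2`. This is
where the nonlocal boundary condition comes from. -/
theorem greenFun_zero_add_greenFun_one (hf : Integrable f unitIntervalMeasure) :
    greenFun f 0 + greenFun f 1 = greenDeriv f 0 := by
  rw [greenDeriv_zero, greenFun, greenFun, ← integral_add (integrable_greenKernel_smul hf 0)
    (integrable_greenKernel_smul hf 1), ← integral_smul]
  refine integral_congr_ae ?_
  filter_upwards [ae_mem_Ioo_unitIntervalMeasure] with y hy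
  rw [← add_smul]
  congr 1
  rw [greenKernel, greenKernel, abs_of_neg (by linarith [hy.1]), abs_of_pos (by linarith [hy.2])]
  ring

/-- The kernel `1 / 2 - 1_{y < s}` is the derivative of `greenKernel s y` in `s`, away from `y = s`.
In this form Fubini can integrate `greenDeriv` back to `greenFun`. -/
theorem greenDeriv_eq_integral_kernel (hf : Integrable f unitIntervalMeasure) {s : ℝ}
    (hs : s ∈ Icc (0 : ℝ) 1) : greenDeriv f s =
      ∫ y in Ioo (0 : ℝ) 1, ((1 / 2 : ℝ) - if y < s then 1 else 0) • f y := by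
  simp only [sub_smul]
  have hf2 : Integrable (fun y => (1 / 2 : ℝ) • f y) unitIntervalMeasure := hf.smul (1 / 2 : ℝ)
  rw [integral_sub hf2, integral_ite_lt_smul f hs, integral_smul, greenDeriv]
  refine hf.bdd_smul 1 (Measurable.ite measurableSet_Iio measurable_const
    measurable_const).aestronglyMeasurable (Eventually.of_forall fun y => ?_)
  split_ifs <;> simp

theorem integral_ite_gt {x y : ℝ} (hx : 0 ≤ x) (hy : 0 ≤ y) :
    ∫ s in 0..x, (if y < s then (1 : ℝ) else 0) = max (x - y) 0 := by
  rcases le_total x y with h | h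
  · rw [max_eq_right (by linarith)]
    refine intervalIntegral.integral_zero_ae (Eventually.of_forall fun s hs => ?_)
    rw [uIoc_of_le hx] at hs
    rw [if_neg (not_lt.2 (hs.2.trans h))]
  · have h1 : ∀ s, (if y < s then (1 : ℝ) else 0) = (Ioi y).indicator (fun _ => (1 : ℝ)) s := by
      intro s
      simp [indicator]
    have h2 : Ioc 0 x ∩ Ioi y = Ioc y x := by
      ext s
      simp only [mem_inter_iff, mem_Ioc, mem_Ioi]
      exact ⟨fun h => ⟨h.2, h.1.2⟩, fun h => ⟨⟨hy.trans_lt h.1, h.2⟩, h.1⟩⟩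
    simp_rw [h1]
    rw [intervalIntegral.integral_of_le hx, setIntegral_indicator measurableSet_Ioi, h2,
      max_eq_left (by linarith)]
    simp [h]

theorem integral_ite_mul_kernel {x y : ℝ} (hx : x ∈ Icc (0 : ℝ) 1) (hy : y ∈ Icc (0 : ℝ) 1) :
    ∫ s in Ioo (0 : ℝ) 1, ((1 / 2 : ℝ) - if y < s then 1 else 0) •
      (((if s < x then 1 else 0 : ℝ) : ℝ) : 𝕜) =
      ((greenKernel x y - greenKernel 0 y : ℝ) : 𝕜) := by
  simp_rw [RCLike.real_smul_eq_coe_mul, ← RCLike.ofReal_mul]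
  rw [integral_ofReal]
  congr 1
  simp_rw [mul_comm _ (ite (_ < x) (1 : ℝ) 0)]
  have := integral_ite_lt_smul (𝕜 := ℝ) (fun s => (1 / 2 : ℝ) - if y < s then 1 else 0) hx
  simp only [smul_eq_mul] at this
  rw [this, intervalIntegral.integral_sub (by simp), integral_ite_gt hx.1 hy.1]
  · rw [greenKernel, greenKernel, zero_sub, abs_neg, abs_of_nonneg hy.1]
    rcases le_total x y with h | h
    · rw [max_eq_right (by linarith), abs_of_nonpos (by linarith)]
      simp
      ring
    · rw [max_eq_left (by linarith), abs_of_nonneg (by linarith)]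
      simp
      ring
  · have h1 : Integrable (fun s : ℝ => if y < s then (1 : ℝ) else 0) (volume.restrict (Ioc 0 x)) :=
      Integrable.of_bound (Measurable.ite measurableSet_Ioi measurable_const
        measurable_const).aestronglyMeasurable 1 (Eventually.of_forall fun s => by
          split_ifs <;> simp)
    exact (intervalIntegrable_iff_integrableOn_Ioc_of_le hx.1).2 h1

theorem greenFun_eq_add_integral (hf : Integrable f unitIntervalMeasure) {x : ℝ}
    (hx : x ∈ Icc (0 : ℝ) 1) : greenFun f x = greenFun f 0 + ∫ s in 0..x, greenDeriv f s := by
  rw [← sub_eq_iff_eq_add', ← integral_ite_lt_smul _ hx]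
  have h1 : ∫ s in Ioo (0 : ℝ) 1, (if s < x then (1 : ℝ) else 0) • greenDeriv f s =
      ∫ s in Ioo (0 : ℝ) 1, ((if s < x then 1 else 0 : ℝ) : 𝕜) *
        ∫ y in Ioo (0 : ℝ) 1, ((1 / 2 : ℝ) - if y < s then 1 else 0) • f y := by
    refine integral_congr_ae ?_
    filter_upwards [ae_mem_Ioo_unitIntervalMeasure] with s hs
    rw [greenDeriv_eq_integral_kernel hf (Ioo_subset_Icc_self hs), RCLike.real_smul_eq_coe_mul]
  rw [h1, integral_mul_integral_kernel_swap hf, greenFun, greenFun,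
    ← integral_sub (integrable_greenKernel_smul hf x) (integrable_greenKernel_smul hf 0)]
  · refine integral_congr_ae ?_
    filter_upwards [ae_mem_Ioo_unitIntervalMeasure] with y hy
    rw [integral_ite_mul_kernel hx (Ioo_subset_Icc_self hy), ← sub_smul,
      RCLike.real_smul_eq_coe_mul]
  · refine Integrable.of_bound (Measurable.aestronglyMeasurable ?_) 1
      (Eventually.of_forall fun s => ?_)
    · exact RCLike.measurable_ofReal.comp
        (Measurable.ite measurableSet_Iio measurable_const measurable_const)
    · split_ifs <;> simp
  · exact measurable_const.sub (Measurable.ite (measurableSet_lt measurable_snd measurable_fst)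
      measurable_const measurable_const)
  · intro s _ y _
    split_ifs <;> norm_num [abs_le]

variable (f : L2UnitInterval 𝕜)

theorem hasWeakDeriv_greenOp : HasWeakDeriv (greenOp 𝕜 f)
    ((continuousOn_greenDeriv f.integrable).memLp_unitIntervalMeasure.toLp (greenDeriv f)) := by
  refine hasWeakDeriv_of_primitive (greenFun f 0) (MemLp.coeFn_toLp _) ?_
  filter_upwards [coeFn_greenOp f, ae_mem_Ioo_unitIntervalMeasure] with x hx hx'
  rw [hx, greenFun_eq_add_integral f.integrable (Ioo_subset_Icc_self hx')]

theorem hasWeakDeriv_greenDeriv : HasWeakDeriv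
    ((continuousOn_greenDeriv f.integrable).memLp_unitIntervalMeasure.toLp (greenDeriv f)) (-f) := by
  refine hasWeakDeriv_of_primitive (greenDeriv f 0) (Lp.coeFn_neg f) ?_
  filter_upwards [MemLp.coeFn_toLp
    (continuousOn_greenDeriv f.integrable).memLp_unitIntervalMeasure] with x hx
  simp only [Pi.neg_apply]
  rw [hx, greenDeriv_zero, greenDeriv, intervalIntegral.integral_neg, sub_eq_add_neg]

theorem greenOp_mem_nonlocalLaplacianDomain : greenOp 𝕜 f ∈ nonlocalLaplacianDomain 𝕜 := by
  refine ⟨⟨_, _, hasWeakDeriv_greenOp f, hasWeakDeriv_greenDeriv f⟩,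
    greenFun f 0, greenFun f 1, greenDeriv f 0, greenDeriv f 1, ?_, ?_, ?_, ?_⟩
  · exact ⟨_, (continuous_greenFun f.integrable).continuousOn, coeFn_greenOp f, rfl, rfl⟩
  · rw [(hasWeakDeriv_greenOp f).weakDeriv_eq]
    exact ⟨_, continuousOn_greenDeriv f.integrable, MemLp.coeFn_toLp _, rfl, rfl⟩
  · rw [greenDeriv_one, neg_neg]
  · rw [greenDeriv_one, neg_neg, greenFun_zero_add_greenFun_one f.integrable]

theorem nonlocalLaplacian_apply (v : (nonlocalLaplacian 𝕜).domain) :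
    nonlocalLaplacian 𝕜 v = weakDeriv (weakDeriv (v : L2UnitInterval 𝕜)) := rfl

theorem nonlocalLaplacian_greenOp (h : greenOp 𝕜 f ∈ (nonlocalLaplacian 𝕜).domain) :
    nonlocalLaplacian 𝕜 ⟨greenOp 𝕜 f, h⟩ = -f := by
  rw [nonlocalLaplacian_apply]
  simp only
  rw [(hasWeakDeriv_greenOp f).weakDeriv_eq, (hasWeakDeriv_greenDeriv f).weakDeriv_eq]

variable {f}

/-- Applying the du Bois-Reymond lemma twice gives `z = d + c x`. The condition `z'(0) = -z'(1)`
forces `c = 0`, and then `0 = z(0) + z(1) = 2 d`. -/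
theorem eq_zero_of_nonlocalLaplacian_eq_zero {z : L2UnitInterval 𝕜}
    (hz : z ∈ (nonlocalLaplacian 𝕜).domain) (h0 : nonlocalLaplacian 𝕜 ⟨z, hz⟩ = 0) : z = 0 := by
  obtain ⟨⟨z', z'', h1, h2⟩, v₀, v₁, d₀, d₁, hv, hd, e1, e2⟩ := hz
  rw [nonlocalLaplacian_apply] at h0
  simp only at h0
  rw [h1.weakDeriv_eq] at hd h0
  rw [h2.weakDeriv_eq] at h0
  subst h0
  obtain ⟨c, hc⟩ := h2.ae_eq_const
  have hq : MemLp (fun x : ℝ => (x : 𝕜) * c) 2 unitIntervalMeasure :=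
    ContinuousOn.memLp_unitIntervalMeasure (by fun_prop)
  have hqw : HasWeakDeriv (hq.toLp _) z' := by
    refine hasWeakDeriv_of_primitive 0 (g := fun _ => c) hc ?_
    filter_upwards [hq.coeFn_toLp] with x hx
    rw [hx, intervalIntegral.integral_const, zero_add, sub_zero, RCLike.real_smul_eq_coe_mul]
  have hzq : HasWeakDeriv (z + (-1 : 𝕜) • hq.toLp _) 0 := by
    have := h1.add (hqw.smul (-1 : 𝕜))
    simpa using this
  obtain ⟨d, hd'⟩ := hzq.ae_eq_const
  have hz' : z =ᵐ[unitIntervalMeasure] fun x => d + (x : 𝕜) * c := by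
    filter_upwards [hd', hq.coeFn_toLp, Lp.coeFn_add z ((-1 : 𝕜) • hq.toLp _),
      Lp.coeFn_smul (-1 : 𝕜) (hq.toLp _)] with x k1 k2 k3 k4
    rw [k3, Pi.add_apply, k4, Pi.smul_apply, k2] at k1
    rw [← k1]
    simp
  obtain ⟨a1, a2⟩ := hv.eq_of_ae_eq (by fun_prop) hz'
  obtain ⟨a3, a4⟩ := hd.eq_of_ae_eq (f := fun _ => c) (by fun_prop) hc
  subst a3 a4
  have c0 : d₁ = 0 := by
    have : (2 : 𝕜) * d₁ = 0 := by linear_combination e1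
    simpa using this
  subst c0
  have dz : d = 0 := by
    simp only [RCLike.ofReal_zero, mul_zero, add_zero] at a1 a2
    rw [a1, a2] at e2
    have : (2 : 𝕜) * d = 0 := by linear_combination -e2
    simpa using this
  subst dz
  refine Lp.ext ?_
  filter_upwards [hz', Lp.coeFn_zero 𝕜 2 unitIntervalMeasure] with x k1 k2
  rw [k1, k2]
  simp

/-- `greenOp` is the inverse of the negative of `nonlocalLaplacian`. -/
theorem nonlocalLaplacian_eq_iff (v w : L2UnitInterval 𝕜) :
    (∃ h : v ∈ (nonlocalLaplacian 𝕜).domain, nonlocalLaplacian 𝕜 ⟨v, h⟩ = w) ↔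
      v = -greenOp 𝕜 w := by
  constructor
  · rintro ⟨h, rfl⟩
    set w := nonlocalLaplacian 𝕜 ⟨v, h⟩ with hw
    have hg : greenOp 𝕜 w ∈ (nonlocalLaplacian 𝕜).domain := greenOp_mem_nonlocalLaplacianDomain w
    refine eq_neg_of_add_eq_zero_left (eq_zero_of_nonlocalLaplacian_eq_zero (add_mem h hg) ?_)
    have := (nonlocalLaplacian 𝕜).map_add ⟨v, h⟩ ⟨_, hg⟩
    rw [nonlocalLaplacian_greenOp, ← hw, add_neg_cancel] at this
    exact this
  · rintro rfl
    have hg : greenOp 𝕜 (-w) ∈ (nonlocalLaplacian 𝕜).domain :=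
      greenOp_mem_nonlocalLaplacianDomain (-w)
    rw [← map_neg]
    exact ⟨hg, by rw [nonlocalLaplacian_greenOp, neg_neg]⟩

theorem greenOp_eq_zero_iff (f : L2UnitInterval 𝕜) : greenOp 𝕜 f = 0 ↔ f = 0 := by
  refine ⟨fun h => ?_, fun h => by rw [h, map_zero]⟩
  obtain ⟨h1, h2⟩ := (nonlocalLaplacian_eq_iff 0 f).2 (by rw [h, neg_zero])
  rw [← h2]
  exact (nonlocalLaplacian 𝕜).map_zero

theorem inner_greenOp_left (f g : L2UnitInterval 𝕜) :
    inner 𝕜 (greenOp 𝕜 f) g = inner 𝕜 f (greenOp 𝕜 g) := greenOp_isSymmetric f g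

/-- If `x` is orthogonal to the domain, then it is orthogonal to `G (G x)`. Symmetry gives `‖G x‖² =
0`, and `G` is injective. -/
theorem dense_nonlocalLaplacian_domain :
    Dense ((nonlocalLaplacian 𝕜).domain : Set (L2UnitInterval 𝕜)) := by
  rw [Submodule.dense_iff_topologicalClosure_eq_top, Submodule.topologicalClosure_eq_top_iff,
    eq_bot_iff]
  intro x hx
  have h := hx _ (greenOp_mem_nonlocalLaplacianDomain (greenOp 𝕜 x))
  rw [inner_greenOp_left, inner_self_eq_zero] at h
  exact (greenOp_eq_zero_iff x).1 h

/-- The graph consists of the pairs `(-G w, w)`. Since `G` is bounded, everywhere defined and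
symmetric, testing against these pairs shows that the adjoint graph is the same set. -/
theorem nonlocalLaplacian_isSelfAdjoint : IsSelfAdjoint (nonlocalLaplacian 𝕜) := by
  rw [LinearPMap.isSelfAdjoint_def]
  refine LinearPMap.eq_of_eq_graph ?_
  rw [LinearPMap.adjoint_graph_eq_graph_adjoint (T := nonlocalLaplacian 𝕜)
    dense_nonlocalLaplacian_domain]
  ext ⟨y, z⟩
  have hg : ∀ v w : L2UnitInterval 𝕜, (v, w) ∈ (nonlocalLaplacian 𝕜).graph ↔ v = -greenOp 𝕜 w := by
    intro v w
    rw [← nonlocalLaplacian_eq_iff, LinearPMap.mem_graph_iff]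
    constructor
    · rintro ⟨v', rfl, h2⟩
      exact ⟨v'.2, h2⟩
    · rintro ⟨h1, h2⟩
      exact ⟨⟨v, h1⟩, rfl, h2⟩
  rw [Submodule.mem_adjoint_iff, hg]
  constructor
  · intro h
    refine ext_inner_left 𝕜 (E := L2UnitInterval 𝕜) fun f => ?_
    have hm : (-greenOp 𝕜 f, f) ∈ (nonlocalLaplacian 𝕜).graph := by rw [hg]
    have := h _ _ hm
    rw [inner_neg_left, inner_greenOp_left] at this
    rw [inner_neg_right]
    linear_combination this
  · rintro rfl v w hvw
    rw [(hg v w).1 hvw]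
    simp only [inner_neg_left, inner_neg_right, inner_greenOp_left, sub_self]

end GreenFunction

/-! ### Eigenvalues and the ground state -/

section EigenvalueEquation

variable {𝕜 : Type*} [RCLike 𝕜]

/-- Solutions of `H'' = -l H` on `[0,1]` are combinations of a fundamental system `C`, `S`. -/
theorem exists_eq_fundamental_system {H H₁ : ℝ → 𝕜} {C S : ℝ → ℝ} {l : ℝ}
    (hH : ∀ x ∈ Icc (0 : ℝ) 1, HasDerivAt H (H₁ x) x)
    (hH₁ : ∀ x ∈ Icc (0 : ℝ) 1, HasDerivAt H₁ (-l • H x) x)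
    (hC : ∀ x, HasDerivAt C (-l * S x) x) (hS : ∀ x, HasDerivAt S (C x) x)
    (hCS : ∀ x, C x ^ 2 + l * S x ^ 2 = 1) :
    ∃ α β : 𝕜, ∀ x ∈ Icc (0 : ℝ) 1, H x = C x • α + S x • β ∧ H₁ x = C x • β - (l * S x) • α := by
  -- Variation of constants: the fundamental matrix has determinant `C² + l S² = 1`, and its inverse
  -- applied to `(H, H₁)` is constant.
  have hα : ∀ x ∈ Icc (0 : ℝ) 1, HasDerivAt (fun x => C x • H x - S x • H₁ x) 0 x := by
    intro x hx
    have h := ((hC x).smul (hH x hx)).sub ((hS x).smul (hH₁ x hx))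
    have e : (C x • H₁ x + (-l * S x) • H x) - (S x • (-l • H x) + C x • H₁ x) = 0 := by module
    rw [e] at h
    exact h
  have hβ : ∀ x ∈ Icc (0 : ℝ) 1, HasDerivAt (fun x => (l * S x) • H x + C x • H₁ x) 0 x := by
    intro x hx
    have h := (((hS x).const_mul l).smul (hH x hx)).add ((hC x).smul (hH₁ x hx))
    have e : ((l * S x) • H₁ x + (l * C x) • H x) + (C x • (-l • H x) + (-l * S x) • H₁ x) = 0 := by
      module
    rw [e] at h
    exact h
  have kα := constant_of_has_deriv_right_zero
    (fun x hx => (hα x hx).continuousAt.continuousWithinAt)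
    (fun x hx => (hα x (Ico_subset_Icc_self hx)).hasDerivWithinAt)
  have kβ := constant_of_has_deriv_right_zero
    (fun x hx => (hβ x hx).continuousAt.continuousWithinAt)
    (fun x hx => (hβ x (Ico_subset_Icc_self hx)).hasDerivWithinAt)
  refine ⟨C 0 • H 0 - S 0 • H₁ 0, (l * S 0) • H 0 + C 0 • H₁ 0, fun x hx => ⟨?_, ?_⟩⟩
  · rw [← kα x hx, ← kβ x hx]
    calc H x = (C x ^ 2 + l * S x ^ 2) • H x := by rw [hCS, one_smul]
      _ = _ := by module
  · rw [← kα x hx, ← kβ x hx]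
    calc H₁ x = (C x ^ 2 + l * S x ^ 2) • H₁ x := by rw [hCS, one_smul]
      _ = _ := by module

/-- An eigenvector of `greenOp` has a representative that solves the eigenvalue equation. -/
theorem exists_classical_eigenfunction {v : L2UnitInterval 𝕜} {l : ℝ}
    (hv : v = (l : 𝕜) • greenOp 𝕜 v) :
    ∃ H H₁ : ℝ → 𝕜, v =ᵐ[unitIntervalMeasure] H ∧
      (∀ x ∈ Icc (0 : ℝ) 1, HasDerivAt H (H₁ x) x) ∧
      (∀ x ∈ Icc (0 : ℝ) 1, HasDerivAt H₁ (-l • H x) x) ∧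
      H₁ 1 = -H₁ 0 ∧ H 0 + H 1 = H₁ 0 := by
  set h : ℝ → 𝕜 := fun x => l • greenFun v x with hh
  have hc : Continuous h := (continuous_greenFun v.integrable).const_smul l
  have hvh : v =ᵐ[unitIntervalMeasure] h := by
    have h1 : v =ᵐ[unitIntervalMeasure] ((l : 𝕜) • greenOp 𝕜 v : L2UnitInterval 𝕜) := by
      rw [← hv]
    filter_upwards [h1, Lp.coeFn_smul (l : 𝕜) (greenOp 𝕜 v), coeFn_greenOp v] with x h1 h2 h3
    rw [h1, h2, Pi.smul_apply, h3, smul_eq_mul, ← RCLike.real_smul_eq_coe_mul]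
  have hi : Integrable h unitIntervalMeasure := v.integrable.congr hvh
  have hgf : greenFun v = greenFun h := greenFun_congr hvh
  set H₁ : ℝ → 𝕜 := fun s => l • ((1 / 2 : ℝ) • (∫ y in Ioo (0 : ℝ) 1, h y) - ∫ y in 0..s, h y) with hH₁
  have hH₁d : ∀ x, HasDerivAt H₁ (-l • h x) x := by
    intro x
    have := ((hc.integral_hasStrictDerivAt 0 x).hasDerivAt.const_sub
      ((1 / 2 : ℝ) • (∫ y in Ioo (0 : ℝ) 1, h y))).const_smul l
    rw [smul_neg, ← neg_smul] at this
    exact this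
  have hH₁c : Continuous H₁ := continuous_iff_continuousAt.2 fun x => (hH₁d x).continuousAt
  have hH₁g : ∀ s, H₁ s = l • greenDeriv h s := fun s => rfl
  -- The function `h` is replaced by this primitive of `H₁`, which agrees with it on `[0,1]` and has
  -- a two-sided derivative at the endpoints as well.
  set H : ℝ → 𝕜 := fun x => h 0 + ∫ s in 0..x, H₁ s with hH
  have hHh : ∀ x ∈ Icc (0 : ℝ) 1, H x = h x := by
    intro x hx
    have hhg : ∀ y, h y = l • greenFun h y := fun y => by rw [← hgf]
    simp only [hH, hH₁g]
    rw [intervalIntegral.integral_smul, hhg x, greenFun_eq_add_integral hi hx, smul_add, ← hhg]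
  have hHd : ∀ x, HasDerivAt H (H₁ x) x := fun x =>
    (hH₁c.integral_hasStrictDerivAt 0 x).hasDerivAt.const_add (h 0)
  refine ⟨H, H₁, ?_, fun x _ => hHd x, fun x hx => ?_, ?_, ?_⟩
  · filter_upwards [hvh, ae_mem_Ioo_unitIntervalMeasure] with x h1 h2
    rw [h1, hHh x (Ioo_subset_Icc_self h2)]
  · rw [hHh x hx]
    exact hH₁d x
  · rw [hH₁g, hH₁g, greenDeriv_one, smul_neg]
  · rw [hHh 0 (by simp), hHh 1 (by simp), hH₁g, ← greenFun_zero_add_greenFun_one hi, smul_add, ← hgf]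

/-- The endpoint values are those of `C` even and `S` odd about `1/2`. The condition `H'(1) =
-H'(0)` becomes `2 c β = 0`, so for `c ≠ 0` the odd part vanishes. The remaining condition `H(0) +
H(1) = H'(0)` becomes the characteristic equation `(l s - 2 c) α = 0`. -/
theorem eigenvector_eq_fundamental_solution {v : L2UnitInterval 𝕜} {l c s : ℝ} {C S : ℝ → ℝ}
    (hv : v = (l : 𝕜) • greenOp 𝕜 v)
    (hC : ∀ x, HasDerivAt C (-l * S x) x) (hS : ∀ x, HasDerivAt S (C x) x)
    (hCS : ∀ x, C x ^ 2 + l * S x ^ 2 = 1) (hC0 : C 0 = c) (hC1 : C 1 = c) (hS0 : S 0 = -s)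
    (hS1 : S 1 = s) (hc : c ≠ 0) :
    ∃ α : 𝕜, (l * s - 2 * c) • α = 0 ∧ ∀ᵐ x ∂unitIntervalMeasure, v x = C x • α := by
  obtain ⟨H, H₁, h1, h2, h3, h4, h5⟩ := exists_classical_eigenfunction hv
  obtain ⟨α, β, h⟩ := exists_eq_fundamental_system h2 h3 hC hS hCS
  obtain ⟨a0, b0⟩ := h 0 (by simp)
  obtain ⟨a1, b1⟩ := h 1 (by simp)
  rw [hC0, hS0] at a0 b0
  rw [hC1, hS1] at a1 b1
  have hβ : β = 0 := by
    have : (2 * c) • β = 0 := by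
      calc (2 * c) • β = H₁ 1 + H₁ 0 := by rw [b0, b1]; module
        _ = 0 := by rw [h4, neg_add_cancel]
    exact (smul_eq_zero.1 this).resolve_left (by simpa using hc)
  subst hβ
  refine ⟨α, ?_, ?_⟩
  · calc (l * s - 2 * c) • α = H₁ 0 - (H 0 + H 1) := by rw [a0, a1, b0]; module
      _ = 0 := by rw [h5, sub_self]
  · filter_upwards [h1, ae_mem_Ioo_unitIntervalMeasure] with x k1 k2
    rw [k1, (h x (Ioo_subset_Icc_self k2)).1, smul_zero, add_zero]

theorem L2UnitInterval.eq_zero_of_ae {v : L2UnitInterval 𝕜}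
    (h : ∀ᵐ x ∂unitIntervalMeasure, v x = 0) : v = 0 := by
  refine Lp.ext ?_
  filter_upwards [h, Lp.coeFn_zero 𝕜 2 unitIntervalMeasure] with x h1 h2
  rw [h1, h2, Pi.zero_apply]

/-- With `l = -k²` the fundamental system is hyperbolic, and `l sinh (k/2) / k < 0 < 2 cosh (k/2)`
excludes a solution of the characteristic equation. -/
theorem eigenvector_eq_zero_of_neg {v : L2UnitInterval 𝕜} {l : ℝ} (hl : l < 0)
    (hv : v = (l : 𝕜) • greenOp 𝕜 v) : v = 0 := by
  set k := √(-l) with hk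
  have hk0 : 0 < k := Real.sqrt_pos.2 (by linarith)
  have hk2 : l = -k ^ 2 := by rw [hk, Real.sq_sqrt (by linarith), neg_neg]
  have hd : ∀ x : ℝ, HasDerivAt (fun x => k * (x - 1 / 2)) k x := fun x => by
    simpa only [mul_one] using ((hasDerivAt_id' x).sub_const (1 / 2)).const_mul k
  have hC : ∀ x, HasDerivAt (fun x => Real.cosh (k * (x - 1 / 2)))
      (-l * (Real.sinh (k * (x - 1 / 2)) / k)) x := fun x => by
    refine (hd x).cosh.congr_deriv ?_
    rw [hk2]
    field_simp
  have hS : ∀ x, HasDerivAt (fun x => Real.sinh (k * (x - 1 / 2)) / k)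
      (Real.cosh (k * (x - 1 / 2))) x := fun x => by
    refine ((hd x).sinh.div_const k).congr_deriv ?_
    field_simp
  have hCS : ∀ x, Real.cosh (k * (x - 1 / 2)) ^ 2 +
      l * (Real.sinh (k * (x - 1 / 2)) / k) ^ 2 = 1 := fun x => by
    rw [hk2, Real.cosh_sq]
    field_simp
    ring
  obtain ⟨α, h1, h2⟩ := eigenvector_eq_fundamental_solution (c := Real.cosh (k / 2))
    (s := Real.sinh (k / 2) / k) (C := fun x => Real.cosh (k * (x - 1 / 2)))
    (S := fun x => Real.sinh (k * (x - 1 / 2)) / k) hv hC hS hCS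
    (by rw [← Real.cosh_neg]; ring_nf) (by ring_nf) (by rw [← neg_div, ← Real.sinh_neg]; ring_nf)
    (by ring_nf) (Real.cosh_pos _).ne'
  have hα : α = 0 := by
    refine (smul_eq_zero.1 h1).resolve_left (ne_of_lt ?_)
    have hs : 0 < Real.sinh (k / 2) := Real.sinh_pos_iff.2 (by positivity)
    have hc := Real.cosh_pos (k / 2)
    have : l * (Real.sinh (k / 2) / k) < 0 := mul_neg_of_neg_of_pos hl (by positivity)
    linarith
  refine L2UnitInterval.eq_zero_of_ae ?_
  filter_upwards [h2] with x hx
  rw [hx, hα, smul_zero]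

/-- The bound `√l < π` ensures `cos (√l / 2) > 0`, which excludes odd eigenfunctions. The
characteristic equation `l s = 2 c` with `s = sin (√l / 2) / √l` is then the stated equation for `√l
/ 2`. -/
theorem eigenvector_of_lt_pi_sq {v : L2UnitInterval 𝕜} (hv0 : v ≠ 0) {l : ℝ} (hl : 0 < l)
    (hlπ : l < Real.pi ^ 2) (hv : v = (l : 𝕜) • greenOp 𝕜 v) :
    √l / 2 ∈ Ioo 0 (Real.pi / 2) ∧ √l / 2 * Real.sin (√l / 2) = Real.cos (√l / 2) ∧
      ∃ α : 𝕜, ∀ᵐ x ∂unitIntervalMeasure, v x = Real.cos (2 * (√l / 2) * (x - 1 / 2)) • α := by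
  set k := √l with hk
  have hk0 : 0 < k := Real.sqrt_pos.2 hl
  have hk2 : l = k ^ 2 := by rw [hk, Real.sq_sqrt hl.le]
  have hkπ : k < Real.pi := by
    rw [hk, Real.sqrt_lt' Real.pi_pos]
    exact hlπ
  have hmem : k / 2 ∈ Ioo 0 (Real.pi / 2) := ⟨by positivity, by linarith⟩
  have hd : ∀ x : ℝ, HasDerivAt (fun x => k * (x - 1 / 2)) k x := fun x => by
    simpa only [mul_one] using ((hasDerivAt_id' x).sub_const (1 / 2)).const_mul k
  have hcpos : 0 < Real.cos (k / 2) := Real.cos_pos_of_mem_Ioo ⟨by linarith, hmem.2⟩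
  have hC : ∀ x, HasDerivAt (fun x => Real.cos (k * (x - 1 / 2)))
      (-l * (Real.sin (k * (x - 1 / 2)) / k)) x := fun x => by
    refine (hd x).cos.congr_deriv ?_
    rw [hk2]
    field_simp
  have hS : ∀ x, HasDerivAt (fun x => Real.sin (k * (x - 1 / 2)) / k)
      (Real.cos (k * (x - 1 / 2))) x := fun x => by
    refine ((hd x).sin.div_const k).congr_deriv ?_
    field_simp
  have hCS : ∀ x, Real.cos (k * (x - 1 / 2)) ^ 2 +
      l * (Real.sin (k * (x - 1 / 2)) / k) ^ 2 = 1 := fun x => by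
    rw [hk2, Real.cos_sq']
    field_simp
    ring
  obtain ⟨α, h1, h2⟩ := eigenvector_eq_fundamental_solution (c := Real.cos (k / 2))
    (s := Real.sin (k / 2) / k) (C := fun x => Real.cos (k * (x - 1 / 2)))
    (S := fun x => Real.sin (k * (x - 1 / 2)) / k) hv hC hS hCS
    (by rw [← Real.cos_neg]; ring_nf) (by ring_nf) (by rw [← neg_div, ← Real.sin_neg]; ring_nf)
    (by ring_nf) hcpos.ne'
  refine ⟨hmem, ?_, α, ?_⟩
  · rcases smul_eq_zero.1 h1 with h | h
    · rw [hk2] at h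
      field_simp at h
      linarith
    · refine absurd (L2UnitInterval.eq_zero_of_ae ?_) hv0
      filter_upwards [h2] with x hx
      rw [hx, h, smul_zero]
  · filter_upwards [h2] with x hx
    rw [hx, mul_div_cancel₀ k two_ne_zero]

/-- On `(0, π/2)` the left side `a sin a` increases while `cos a` strictly decreases. -/
theorem eq_of_mul_sin_eq_cos {a b : ℝ} (ha : a ∈ Ioo 0 (Real.pi / 2)) (hb : b ∈ Ioo 0 (Real.pi / 2))
    (hae : a * Real.sin a = Real.cos a) (hbe : b * Real.sin b = Real.cos b) : a = b := by
  have key : ∀ {a b : ℝ}, a ∈ Ioo 0 (Real.pi / 2) → b ∈ Ioo 0 (Real.pi / 2) →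
      a * Real.sin a = Real.cos a → b * Real.sin b = Real.cos b → ¬ a < b := by
    intro a b ha hb hae hbe hab
    have h1 : Real.sin a ≤ Real.sin b :=
      (Real.sin_lt_sin_of_lt_of_le_pi_div_two (by linarith [ha.1, Real.pi_pos]) hb.2.le hab).le
    have h2 : Real.cos b < Real.cos a :=
      Real.cos_lt_cos_of_nonneg_of_le_pi_div_two ha.1.le hb.2.le hab
    have h3 : 0 < Real.sin a := Real.sin_pos_of_pos_of_lt_pi ha.1 (by linarith [ha.2, Real.pi_pos])
    nlinarith [ha.1, mul_le_mul hab.le h1 h3.le hb.1.le]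
  exact le_antisymm (not_lt.1 (key hb ha hbe hae)) (not_lt.1 (key ha hb hae hbe))

theorem exists_mul_sin_eq_cos : ∃ a ∈ Ioo 0 (Real.pi / 2), a * Real.sin a = Real.cos a := by
  have hc : ContinuousOn (fun a : ℝ => a * Real.sin a - Real.cos a) (Icc 0 (Real.pi / 2)) := by
    fun_prop
  have h0 : (0 : ℝ) ∈ Ioo ((0 : ℝ) * Real.sin 0 - Real.cos 0)
      (Real.pi / 2 * Real.sin (Real.pi / 2) - Real.cos (Real.pi / 2)) := by
    simp [Real.pi_pos]
  obtain ⟨a, ha, h⟩ := intermediate_value_Ioo (by positivity) hc h0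
  exact ⟨a, ha, sub_eq_zero.1 h⟩

theorem hasWeakDeriv_of_hasDerivAt {F F' : ℝ → 𝕜} (hF' : Continuous F')
    (h : ∀ x, HasDerivAt F (F' x) x) (hF : MemLp F 2 unitIntervalMeasure)
    (hF'm : MemLp F' 2 unitIntervalMeasure) : HasWeakDeriv (hF.toLp F) (hF'm.toLp F') := by
  refine hasWeakDeriv_of_primitive (F 0) hF'm.coeFn_toLp ?_
  filter_upwards [hF.coeFn_toLp] with x hx
  rw [hx, intervalIntegral.integral_eq_sub_of_hasDerivAt (fun y _ => h y)
    (hF'.intervalIntegrable _ _), add_sub_cancel]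

/-- The function `cos (2 a (x - 1 / 2))`; it is the first eigenfunction of `nonlocalLaplacian` if
`a sin a = cos a` with `0 < a < π / 2`. -/
noncomputable def groundState (a x : ℝ) : ℝ := Real.cos (2 * a * (x - 1 / 2))

theorem continuous_groundState (a : ℝ) : Continuous (groundState a) := by
  unfold groundState
  fun_prop

variable (𝕜) in
theorem memLp_groundState (a : ℝ) :
    MemLp (fun x => (groundState a x : 𝕜)) 2 unitIntervalMeasure :=
  ContinuousOn.memLp_unitIntervalMeasure
    (RCLike.continuous_ofReal.comp (continuous_groundState a)).continuousOn

variable (𝕜) in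
/-- `groundState` as an element of `L²(0,1)`. -/
noncomputable def groundStateLp (a : ℝ) : L2UnitInterval 𝕜 := (memLp_groundState 𝕜 a).toLp _

theorem coeFn_groundStateLp (a : ℝ) :
    groundStateLp 𝕜 a =ᵐ[unitIntervalMeasure] fun x => (groundState a x : 𝕜) :=
  (memLp_groundState 𝕜 a).coeFn_toLp

theorem HasDerivAt.rclike_ofReal {f : ℝ → ℝ} {f' x : ℝ} (h : HasDerivAt f f' x) :
    HasDerivAt (fun y => (f y : 𝕜)) (f' : 𝕜) x :=
  (RCLike.ofRealCLM (K := 𝕜)).hasFDerivAt.comp_hasDerivAt x h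

/-- The ground state lies in the domain with `A φ = -4 a² φ`, and the equation `a sin a = cos a` is
its boundary condition `φ'(0) = φ(0) + φ(1)`. Inverting `-A` gives the claim. -/
theorem groundStateLp_eq_smul_greenOp {a : ℝ} (ha : a * Real.sin a = Real.cos a) :
    groundStateLp 𝕜 a = ((4 * a ^ 2 : ℝ) : 𝕜) • greenOp 𝕜 (groundStateLp 𝕜 a) := by
  have hd : ∀ x : ℝ, HasDerivAt (fun x => 2 * a * (x - 1 / 2)) (2 * a) x := fun x => by
    simpa only [mul_one] using ((hasDerivAt_id' x).sub_const (1 / 2)).const_mul (2 * a)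
  have h1 : ∀ x, HasDerivAt (fun x => (groundState a x : 𝕜))
      ((-(2 * a) * Real.sin (2 * a * (x - 1 / 2)) : ℝ) : 𝕜) x := fun x => by
    refine HasDerivAt.rclike_ofReal ?_
    exact (hd x).cos.congr_deriv (by ring)
  have h2 : ∀ x, HasDerivAt (fun x => ((-(2 * a) * Real.sin (2 * a * (x - 1 / 2)) : ℝ) : 𝕜))
      ((-(4 * a ^ 2) * groundState a x : ℝ) : 𝕜) x := fun x => by
    refine HasDerivAt.rclike_ofReal ?_
    exact ((hd x).sin.const_mul (-(2 * a))).congr_deriv (by unfold groundState; ring)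
  have c1 : Continuous (fun x => ((-(2 * a) * Real.sin (2 * a * (x - 1 / 2)) : ℝ) : 𝕜)) :=
    RCLike.continuous_ofReal.comp (by fun_prop)
  have c2 : Continuous (fun x => ((-(4 * a ^ 2) * groundState a x : ℝ) : 𝕜)) :=
    RCLike.continuous_ofReal.comp ((continuous_groundState a).const_mul _)
  have m1 := c1.continuousOn.memLp_unitIntervalMeasure
  have m2 := c2.continuousOn.memLp_unitIntervalMeasure
  have w1 : HasWeakDeriv (groundStateLp 𝕜 a) (m1.toLp _) := hasWeakDeriv_of_hasDerivAt c1 h1 _ _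
  have w2 : HasWeakDeriv (m1.toLp _) (m2.toLp _) := hasWeakDeriv_of_hasDerivAt c2 h2 _ _
  have e2 : m2.toLp _ = (-(4 * a ^ 2 : ℝ) : 𝕜) • groundStateLp 𝕜 a := by
    refine Lp.ext ?_
    filter_upwards [m2.coeFn_toLp, coeFn_groundStateLp (𝕜 := 𝕜) a,
      Lp.coeFn_smul (-(4 * a ^ 2 : ℝ) : 𝕜) (groundStateLp 𝕜 a)] with x k1 k2 k3
    rw [k1, k3, Pi.smul_apply, k2]
    push_cast
    rw [smul_eq_mul]
  have hmem : groundStateLp 𝕜 a ∈ (nonlocalLaplacian 𝕜).domain := by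
    refine ⟨⟨_, _, w1, w2⟩, _, _, ((-(2 * a) * Real.sin (2 * a * (0 - 1 / 2)) : ℝ) : 𝕜),
      ((-(2 * a) * Real.sin (2 * a * (1 - 1 / 2)) : ℝ) : 𝕜), ⟨_, (RCLike.continuous_ofReal.comp
      (continuous_groundState a)).continuousOn, coeFn_groundStateLp a, rfl, rfl⟩, ?_, ?_, ?_⟩
    · rw [w1.weakDeriv_eq]
      exact ⟨_, c1.continuousOn, m1.coeFn_toLp, rfl, rfl⟩
    · rw [← RCLike.ofReal_neg]
      congr 1
      rw [show 2 * a * (0 - 1 / 2) = -a by ring, show 2 * a * (1 - 1 / 2) = a by ring, Real.sin_neg]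
      ring
    · simp only [Function.comp_apply]
      rw [← RCLike.ofReal_neg, ← RCLike.ofReal_add]
      congr 1
      unfold groundState
      rw [show 2 * a * (0 - 1 / 2) = -a by ring, show 2 * a * (1 - 1 / 2) = a by ring, Real.cos_neg,
        ← ha]
      ring
  have hA : nonlocalLaplacian 𝕜 ⟨groundStateLp 𝕜 a, hmem⟩ =
      (-(4 * a ^ 2 : ℝ) : 𝕜) • groundStateLp 𝕜 a := by
    rw [nonlocalLaplacian_apply, ← e2]
    simp only
    rw [w1.weakDeriv_eq, w2.weakDeriv_eq]
  have := (nonlocalLaplacian_eq_iff _ _).1 ⟨hmem, hA⟩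
  rwa [map_smul, neg_smul, neg_neg] at this

/-- Location of the eigenvalues of `greenOp`. -/
theorem greenOp_eigenvalue {a : ℝ} (ha : a ∈ Ioo 0 (Real.pi / 2)) (hae : a * Real.sin a = Real.cos a)
    {v : L2UnitInterval 𝕜} (hv0 : v ≠ 0) {m : ℝ} (hv : greenOp 𝕜 v = (m : 𝕜) • v) :
    0 < m ∧ (m⁻¹ < Real.pi ^ 2 → m⁻¹ = 4 * a ^ 2 ∧ ∃ α : 𝕜, v = α • groundStateLp 𝕜 a) := by
  have hm0 : m ≠ 0 := by
    rintro rfl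
    refine hv0 ((greenOp_eq_zero_iff v).1 ?_)
    rw [hv, RCLike.ofReal_zero, zero_smul]
  have hv' : v = ((m⁻¹ : ℝ) : 𝕜) • greenOp 𝕜 v := by
    rw [hv, smul_smul, ← RCLike.ofReal_mul, inv_mul_cancel₀ hm0, RCLike.ofReal_one, one_smul]
  have hm : 0 < m := by
    refine lt_of_le_of_ne (not_lt.1 fun h => hv0 ?_) hm0.symm
    exact eigenvector_eq_zero_of_neg (inv_lt_zero.2 h) hv'
  refine ⟨hm, fun hlt => ?_⟩
  obtain ⟨h1, h2, α, h3⟩ := eigenvector_of_lt_pi_sq hv0 (inv_pos.2 hm) hlt hv'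
  have e := eq_of_mul_sin_eq_cos h1 ha h2 hae
  refine ⟨?_, α, ?_⟩
  · have := Real.sq_sqrt (inv_pos.2 hm).le
    rw [← this, ← e]
    ring
  · rw [e] at h3
    refine Lp.ext ?_
    filter_upwards [h3, Lp.coeFn_smul α (groundStateLp 𝕜 a), coeFn_groundStateLp (𝕜 := 𝕜) a]
      with x k1 k2 k3
    rw [k1, k2, Pi.smul_apply, k3, smul_eq_mul, RCLike.real_smul_eq_coe_mul, mul_comm]
    rfl

end EigenvalueEquation

/-! ### Spectral splitting and eventual positivity -/

section EventualPositivity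

variable {𝕜 : Type*} [RCLike 𝕜] {ι : Type*} {b : HilbertBasis ι 𝕜 (L2UnitInterval 𝕜)} {m : ι → ℝ}

theorem greenOp_eigenvalue_pos (hb : ∀ i, greenOp 𝕜 (b i) = (m i : 𝕜) • b i) (i : ι) : 0 < m i := by
  obtain ⟨a, ha, hae⟩ := exists_mul_sin_eq_cos
  exact (greenOp_eigenvalue ha hae (b.orthonormal.ne_zero i) (hb i)).1

theorem inner_eigenvector_greenOp (hb : ∀ i, greenOp 𝕜 (b i) = (m i : 𝕜) • b i) (i : ι)
    (u : L2UnitInterval 𝕜) : inner 𝕜 (b i) (greenOp 𝕜 u) = m i * inner 𝕜 (b i) u := by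
  rw [← inner_greenOp_left, hb, inner_smul_left, RCLike.conj_ofReal]

theorem nonlocalLaplacian_eq_iff_inner (hb : ∀ i, greenOp 𝕜 (b i) = (m i : 𝕜) • b i)
    (v w : L2UnitInterval 𝕜) :
    (∃ h : v ∈ (nonlocalLaplacian 𝕜).domain, nonlocalLaplacian 𝕜 ⟨v, h⟩ = w) ↔
      ∀ i, inner 𝕜 (b i) w = -(((m i)⁻¹ : ℝ) : 𝕜) * inner 𝕜 (b i) v := by
  have hm : ∀ i, (m i : 𝕜) ≠ 0 := fun i =>
    RCLike.ofReal_ne_zero.2 (greenOp_eigenvalue_pos hb i).ne'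
  rw [nonlocalLaplacian_eq_iff]
  constructor
  · rintro rfl i
    rw [inner_neg_right, inner_eigenvector_greenOp hb, RCLike.ofReal_inv, neg_mul_neg,
      inv_mul_cancel_left₀ (hm i)]
  · intro h
    refine b.ext_inner fun i => ?_
    rw [inner_neg_right, inner_eigenvector_greenOp hb, h, RCLike.ofReal_inv, neg_mul, mul_neg,
      neg_neg, mul_inv_cancel_left₀ (hm i)]

/-- Split `exp (-t l) = exp (-l) exp (-(t - 1) l)`. The first factor absorbs `l²`, since `l² exp
(-l) ≤ 2` for `l ≥ 0`, and the second is at most its value at `p`. -/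
theorem abs_sq_mul_exp_le {t : ℝ} (ht : 1 ≤ t) (p l : ℝ) (hp : 0 ≤ p) :
    |if p ≤ l then l ^ 2 * Real.exp (-(t * l)) else 0| ≤ 2 * Real.exp (-((t - 1) * p)) := by
  split_ifs with h
  · rw [abs_of_nonneg (by positivity)]
    have h1 : l ^ 2 * Real.exp (-l) ≤ 2 := by
      rw [Real.exp_neg, ← div_eq_mul_inv, div_le_iff₀ (Real.exp_pos _)]
      nlinarith [Real.quadratic_le_exp_of_nonneg (hp.trans h)]
    have h2 : Real.exp (-((t - 1) * l)) ≤ Real.exp (-((t - 1) * p)) := by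
      rw [Real.exp_le_exp]
      nlinarith
    calc l ^ 2 * Real.exp (-(t * l)) = l ^ 2 * Real.exp (-l) * Real.exp (-((t - 1) * l)) := by
          rw [mul_assoc, ← Real.exp_add]
          ring_nf
      _ ≤ _ := mul_le_mul h1 h2 (Real.exp_pos _).le zero_le_two
  · rw [abs_zero]
    positivity

/-- The semigroup is the sum of its part on the ground state and a rapidly decaying remainder that
factors through `L¹ → L²` and `L² → L^∞`. -/
theorem exists_diagonalSemigroup_eq_add {a : ℝ} (ha : a ∈ Ioo 0 (Real.pi / 2))
    (hae : a * Real.sin a = Real.cos a) (hb : ∀ i, greenOp 𝕜 (b i) = (m i : 𝕜) • b i)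
    (hm : ∀ i, 0 ≤ (m i)⁻¹) {t : ℝ≥0} (ht : 1 ≤ t) :
    ∃ D : L2UnitInterval 𝕜 →L[𝕜] L2UnitInterval 𝕜,
      (∀ x, ‖D x‖ ≤ 2 * Real.exp (-((t - 1) * Real.pi ^ 2)) * ‖x‖) ∧
      ∀ u, (b.diagonalSemigroup (fun i => (m i)⁻¹) hm).op t u =
        ((Real.exp (-(t * (4 * a ^ 2))) / ‖groundStateLp 𝕜 a‖ ^ 2 : ℝ) : 𝕜) •
          inner 𝕜 (groundStateLp 𝕜 a) u • groundStateLp 𝕜 a +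
        greenOp 𝕜 (D (greenOp 𝕜 u)) := by
  set φ := groundStateLp 𝕜 a with hφ
  set C : ℝ≥0 := ⟨2 * Real.exp (-((t - 1) * Real.pi ^ 2)), by positivity⟩ with hC
  have ht' : (1 : ℝ) ≤ t := NNReal.one_le_coe.2 ht
  -- The factor `(m i)⁻¹ ^ 2` in the entries of `D` cancels the two factors `m i` that come from the
  -- surrounding copies of `greenOp`.
  have hbound : ∀ i, |if Real.pi ^ 2 ≤ (m i)⁻¹ then (m i)⁻¹ ^ 2 * Real.exp (-(t * (m i)⁻¹))
      else 0| ≤ (C : ℝ) := fun i => abs_sq_mul_exp_le ht' _ _ (by positivity)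
  refine ⟨b.diagonal _ C hbound, fun x => b.norm_diagonal_apply_le _ C _ x,
    fun u => b.ext_inner fun i => ?_⟩
  have hmi : (m i : 𝕜) ≠ 0 := RCLike.ofReal_ne_zero.2 (greenOp_eigenvalue_pos hb i).ne'
  have hbi := b.orthonormal.ne_zero i
  rw [HilbertBasis.diagonalSemigroup, b.inner_diagonal, inner_add_right, inner_smul_right,
    inner_smul_right, inner_eigenvector_greenOp hb, b.inner_diagonal, inner_eigenvector_greenOp hb]
  split_ifs with h
  -- Eigenvectors for different eigenvalues are orthogonal, and `4 a² < π² ≤ (m i)⁻¹`, so only the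
  -- remainder acts on `b i`.
  · have h0 : inner 𝕜 (b i) φ = 0 := by
      have h1 := inner_eigenvector_greenOp hb i φ
      have h2 : inner 𝕜 (b i) φ = ((4 * a ^ 2 : ℝ) : 𝕜) * inner 𝕜 (b i) (greenOp 𝕜 φ) := by
        conv_lhs => rw [hφ, groundStateLp_eq_smul_greenOp hae]
        rw [inner_smul_right]
      rw [h1, ← mul_assoc] at h2
      by_contra h3
      have h4 := mul_right_cancel₀ h3 ((one_mul _).trans h2)
      rw [← RCLike.ofReal_mul, ← RCLike.ofReal_one, RCLike.ofReal_inj] at h4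
      have h5 : (m i)⁻¹ = 4 * a ^ 2 := inv_eq_of_mul_eq_one_left h4.symm
      rw [h5] at h
      nlinarith [ha.1, ha.2, Real.pi_pos]
    rw [h0]
    push_cast
    field_simp
    ring
  -- Below `π²` the vector `b i` is a multiple of `φ`: the remainder vanishes on it, and the
  -- rank-one term is `exp (-4 a² t)` times the projection onto `φ`.
  · obtain ⟨h1, α, h2⟩ := (greenOp_eigenvalue ha hae hbi (hb i)).2 (not_le.1 h)
    have hφ0 : φ ≠ 0 := fun h0 => hbi (by rw [h2, ← hφ, h0, smul_zero])
    have hφn : (‖φ‖ : 𝕜) ≠ 0 := RCLike.ofReal_ne_zero.2 (norm_ne_zero_iff.2 hφ0)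
    rw [h1, h2, ← hφ, inner_smul_left, inner_smul_left, inner_self_eq_norm_sq_to_K,
      RCLike.ofReal_div]
    push_cast
    field_simp
    ring

/-- Pointwise complex conjugation on `L²(0,1)`. -/
noncomputable def conjLp (𝕜 : Type*) [RCLike 𝕜] : L2UnitInterval 𝕜 →L[ℝ] L2UnitInterval 𝕜 :=
  ((RCLike.conjCLE : 𝕜 ≃L[ℝ] 𝕜) : 𝕜 →L[ℝ] 𝕜).compLpL 2 unitIntervalMeasure

theorem coeFn_conjLp (u : L2UnitInterval 𝕜) :
    conjLp 𝕜 u =ᵐ[unitIntervalMeasure] fun x => star (u x) := by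
  filter_upwards [ContinuousLinearMap.coeFn_compLpL
    ((RCLike.conjCLE : 𝕜 ≃L[ℝ] 𝕜) : 𝕜 →L[ℝ] 𝕜) u] with x hx
  exact hx

theorem conjLp_smul (c : 𝕜) (u : L2UnitInterval 𝕜) : conjLp 𝕜 (c • u) = star c • conjLp 𝕜 u := by
  refine Lp.ext ?_
  filter_upwards [coeFn_conjLp (c • u), Lp.coeFn_smul c u, Lp.coeFn_smul (star c) (conjLp 𝕜 u),
    coeFn_conjLp u] with x h1 h2 h3 h4
  rw [h1, h2, h3, Pi.smul_apply, Pi.smul_apply, h4, smul_eq_mul, star_mul', smul_eq_mul]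

theorem greenOp_conjLp (u : L2UnitInterval 𝕜) : greenOp 𝕜 (conjLp 𝕜 u) = conjLp 𝕜 (greenOp 𝕜 u) := by
  refine Lp.ext ?_
  filter_upwards [coeFn_greenOp (conjLp 𝕜 u), coeFn_greenOp u, coeFn_conjLp (greenOp 𝕜 u)]
    with x h1 h2 h3
  rw [h1, h3, h2, greenFun_congr (coeFn_conjLp u), ← greenFun_conj]
  rfl

/-- The kernel and the eigenvalues are real, so the conjugate of an eigenvector is an eigenvector
for the same eigenvalue. The identity thus holds on the terms of the basis expansion of `u`. -/
theorem diagonalSemigroup_conjLp (hb : ∀ i, greenOp 𝕜 (b i) = (m i : 𝕜) • b i)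
    (hm : ∀ i, 0 ≤ (m i)⁻¹) (t : ℝ≥0) (u : L2UnitInterval 𝕜) :
    (b.diagonalSemigroup (fun i => (m i)⁻¹) hm).op t (conjLp 𝕜 u) =
      conjLp 𝕜 ((b.diagonalSemigroup (fun i => (m i)⁻¹) hm).op t u) := by
  set T := b.diagonalSemigroup (fun i => (m i)⁻¹) hm with hT
  have hgen := b.diagonalSemigroup_isGeneratedBy _ hm (nonlocalLaplacian_eq_iff_inner hb)
  have hev : ∀ (v : L2UnitInterval 𝕜) i, greenOp 𝕜 v = (m i : 𝕜) • v →
      T.op t v = (Real.exp (-(t * (m i)⁻¹)) : 𝕜) • v := by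
    intro v i hv
    obtain ⟨h1, h2⟩ := (nonlocalLaplacian_eq_iff v (-(((m i)⁻¹ : ℝ) : 𝕜) • v)).2 (by
      rw [map_smul, hv, neg_smul, neg_neg, smul_smul, ← RCLike.ofReal_mul,
        inv_mul_cancel₀ (greenOp_eigenvalue_pos hb i).ne', RCLike.ofReal_one, one_smul])
    exact hgen.op_eigenvector h1 h2 t
  have s1 := ((b.hasSum_repr u).mapL (conjLp 𝕜)).mapL (T.op t)
  have s2 := ((b.hasSum_repr u).mapL (T.op t)).mapL (conjLp 𝕜)
  refine s1.unique ?_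
  convert s2 using 2 with i
  rw [conjLp_smul, map_smul, map_smul, conjLp_smul, hev (b i) i (hb i), conjLp_smul,
    hev (conjLp 𝕜 (b i)) i (by rw [greenOp_conjLp, hb, conjLp_smul, RCLike.star_def,
      RCLike.conj_ofReal])]
  rw [RCLike.star_def, RCLike.conj_ofReal]

theorem groundState_bounds {a x : ℝ} (ha : a ∈ Ioo 0 (Real.pi / 2)) (hx : x ∈ Icc (0 : ℝ) 1) :
    Real.cos a ≤ groundState a x ∧ groundState a x ≤ 1 := by
  refine ⟨?_, Real.cos_le_one _⟩
  unfold groundState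
  rw [← Real.cos_abs (2 * a * (x - 1 / 2))]
  have h : |2 * a * (x - 1 / 2)| ≤ a := by
    rw [abs_le]
    constructor <;> nlinarith [ha.1, hx.1, hx.2]
  exact Real.cos_le_cos_of_nonneg_of_le_pi (abs_nonneg _) (by linarith [ha.2, Real.pi_pos]) h

theorem norm_groundStateLp_le (a : ℝ) : ‖groundStateLp 𝕜 a‖ ≤ 1 := by
  refine L2UnitInterval.norm_le_of_ae_bound zero_le_one ?_
  filter_upwards [coeFn_groundStateLp (𝕜 := 𝕜) a] with x hx
  rw [hx, RCLike.norm_ofReal]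
  exact Real.abs_cos_le_one _

theorem IsPositiveL2.norm_eq_re {u : L2UnitInterval 𝕜} (hu : IsPositiveL2 u) :
    ∀ᵐ x ∂unitIntervalMeasure, 0 ≤ ‖u x‖ ∧ u x = ((‖u x‖ : ℝ) : 𝕜) := by
  filter_upwards [hu] with x hx
  refine ⟨norm_nonneg _, ?_⟩
  have h1 : u x = ((RCLike.re (u x) : ℝ) : 𝕜) := by
    conv_lhs => rw [← RCLike.re_add_im (u x), hx.2]
    simp
  have h2 : ‖u x‖ = RCLike.re (u x) := by
    rw [h1, RCLike.norm_ofReal, RCLike.ofReal_re, abs_of_nonneg hx.1]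
  rw [h2]
  exact h1

/-- The lower bound `φ ≥ cos a` makes the ground state coefficient dominate the `L¹` norm of `u`,
the norm in which the remainder is estimated. -/
theorem IsPositiveL2.inner_groundStateLp {a : ℝ} (ha : a ∈ Ioo 0 (Real.pi / 2))
    {u : L2UnitInterval 𝕜} (hu : IsPositiveL2 u) :
    ∃ r : ℝ, inner 𝕜 (groundStateLp 𝕜 a) u = (r : 𝕜) ∧
      Real.cos a * ∫ x in Ioo (0 : ℝ) 1, ‖u x‖ ≤ r := by
  refine ⟨∫ x in Ioo (0 : ℝ) 1, groundState a x * ‖u x‖, ?_, ?_⟩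
  · rw [L2.inner_def, ← integral_ofReal]
    refine integral_congr_ae ?_
    filter_upwards [coeFn_groundStateLp (𝕜 := 𝕜) a, hu.norm_eq_re] with x h1 h2
    rw [h1, RCLike.inner_apply, RCLike.conj_ofReal, RCLike.ofReal_mul, ← h2.2, mul_comm]
  · rw [← integral_const_mul]
    refine integral_mono_ae (u.integrable.norm.const_mul _) ?_ ?_
    · refine u.integrable.norm.bdd_mul (c := 1) (continuous_groundState a).aestronglyMeasurable
        (Eventually.of_forall fun x => Real.abs_cos_le_one _)
    · filter_upwards [ae_mem_Ioo_unitIntervalMeasure] with x hx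
      exact mul_le_mul_of_nonneg_right (groundState_bounds ha (Ioo_subset_Icc_self hx)).1
        (norm_nonneg _)

theorem exists_time_exp_le {a : ℝ} (ha : a ∈ Ioo 0 (Real.pi / 2)) :
    ∃ t₀ : ℝ≥0, 1 ≤ t₀ ∧ ∀ t : ℝ≥0, t₀ ≤ t → Real.exp (-((t - 1) * Real.pi ^ 2)) ≤
      Real.exp (-(t * (4 * a ^ 2))) * Real.cos a ^ 2 := by
  have hd : 0 < Real.cos a := Real.cos_pos_of_mem_Ioo ⟨by linarith [ha.1, ha.2], ha.2⟩
  have hg : 0 < Real.pi ^ 2 - 4 * a ^ 2 := by nlinarith [ha.1, ha.2, Real.pi_pos]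
  set K := Real.exp (Real.pi ^ 2) / Real.cos a ^ 2 with hK
  have hK0 : 0 < K := by positivity
  -- With the spectral gap `g = π² - 4 a²`, it suffices that `K ≤ exp (t g)`. The choice of time
  -- gives `K ≤ t g`, and `t g ≤ exp (t g)`.
  refine ⟨max 1 (K / (Real.pi ^ 2 - 4 * a ^ 2)).toNNReal, le_max_left _ _, fun t ht => ?_⟩
  have h1 : K / (Real.pi ^ 2 - 4 * a ^ 2) ≤ t := by
    have h2 : ((K / (Real.pi ^ 2 - 4 * a ^ 2)).toNNReal : ℝ) ≤ t :=
      NNReal.coe_le_coe.2 ((le_max_right _ _).trans ht)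
    exact (Real.le_coe_toNNReal _).trans h2
  rw [div_le_iff₀ hg] at h1
  have h2 : K ≤ Real.exp (t * (Real.pi ^ 2 - 4 * a ^ 2)) :=
    h1.trans ((by linarith : _ ≤ _ + (1 : ℝ)).trans (Real.add_one_le_exp _))
  rw [hK, div_le_iff₀ (by positivity)] at h2
  calc Real.exp (-((t - 1) * Real.pi ^ 2))
      = Real.exp (-(t * Real.pi ^ 2)) * Real.exp (Real.pi ^ 2) := by
        rw [← Real.exp_add]
        ring_nf
    _ ≤ Real.exp (-(t * Real.pi ^ 2)) *
        (Real.exp (t * (Real.pi ^ 2 - 4 * a ^ 2)) * Real.cos a ^ 2) := by gcongr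
    _ = _ := by
        rw [← mul_assoc, ← Real.exp_add]
        ring_nf

theorem diagonalSemigroup_uniformlyEventuallyPositive
    (hb : ∀ i, greenOp 𝕜 (b i) = (m i : 𝕜) • b i) (hm : ∀ i, 0 ≤ (m i)⁻¹) :
    (b.diagonalSemigroup (fun i => (m i)⁻¹) hm).UniformlyEventuallyPositive := by
  obtain ⟨a, ha, hae⟩ := exists_mul_sin_eq_cos
  have hd : 0 < Real.cos a := Real.cos_pos_of_mem_Ioo ⟨by linarith [ha.1, ha.2], ha.2⟩
  obtain ⟨t₀, ht₀, htime⟩ := exists_time_exp_le ha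
  refine ⟨t₀, fun u hu t ht => ?_⟩
  have hconj : conjLp 𝕜 u = u := by
    refine Lp.ext ?_
    filter_upwards [coeFn_conjLp u, hu] with x h1 h2
    rw [h1, RCLike.star_def, RCLike.conj_eq_iff_im]
    exact h2.2
  have hconjT := diagonalSemigroup_conjLp hb hm t u
  rw [hconj] at hconjT
  obtain ⟨D, hD, hsplit⟩ := exists_diagonalSemigroup_eq_add ha hae hb hm (ht₀.trans ht)
  obtain ⟨r, hr, hrle⟩ := hu.inner_groundStateLp ha
  specialize hsplit u
  rw [hr, smul_smul, ← RCLike.ofReal_mul] at hsplit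
  set I := ∫ x in Ioo (0 : ℝ) 1, ‖u x‖ with hI
  have hI0 : 0 ≤ I := integral_nonneg fun _ => norm_nonneg _
  set E := Real.exp (-((t - 1) * Real.pi ^ 2)) with hE
  set w := D (greenOp 𝕜 u) with hw
  -- The inner `greenOp` passes from `L¹` to `L²`; the outer one is estimated pointwise below, again
  -- by `norm_greenFun_le`.
  have hwn : ∫ x in Ioo (0 : ℝ) 1, ‖w x‖ ≤ E * I := by
    refine w.integral_norm_le.trans ((hD _).trans ?_)
    calc 2 * E * ‖greenOp 𝕜 u‖ ≤ 2 * E * (I / 2) := by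
          gcongr
          exact norm_greenOp_apply_le u
      _ = E * I := by ring
  have hφn : 0 < ‖groundStateLp 𝕜 a‖ ^ 2 := by
    refine pow_pos (norm_pos_iff.2 fun h0 => ?_) 2
    have h1 : ∀ᵐ x ∂unitIntervalMeasure, False := by
      filter_upwards [coeFn_groundStateLp (𝕜 := 𝕜) a, ae_mem_Ioo_unitIntervalMeasure,
        (h0 ▸ Lp.coeFn_zero 𝕜 2 unitIntervalMeasure :
          groundStateLp 𝕜 a =ᵐ[unitIntervalMeasure] 0)] with x h1 h2 h3
      rw [h1, Pi.zero_apply, RCLike.ofReal_eq_zero] at h3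
      have := (groundState_bounds ha (Ioo_subset_Icc_self h2)).1
      linarith
    exact h1.exists.choose_spec
  have hφ1 : ‖groundStateLp 𝕜 a‖ ^ 2 ≤ 1 :=
    pow_le_one₀ (norm_nonneg _) (norm_groundStateLp_le a)
  set e := Real.exp (-(t * (4 * a ^ 2))) with he
  have he0 : 0 < e := Real.exp_pos _
  set q := e / ‖groundStateLp 𝕜 a‖ ^ 2 * r with hq
  have hqle : e * (Real.cos a * I) ≤ q := by
    have h1 : e ≤ e / ‖groundStateLp 𝕜 a‖ ^ 2 := by
      rw [le_div_iff₀ hφn]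
      exact mul_le_of_le_one_right he0.le hφ1
    exact mul_le_mul h1 hrle (by positivity) (by positivity)
  have hq0 : 0 ≤ q := le_trans (by positivity) hqle
  have hEe : E ≤ e * Real.cos a ^ 2 := htime t ht
  rw [hsplit]
  have him : ∀ᵐ x ∂unitIntervalMeasure, RCLike.im
      (((q : 𝕜) • groundStateLp 𝕜 a + greenOp 𝕜 w : L2UnitInterval 𝕜) x) = 0 := by
    rw [← hsplit]
    have h1 := coeFn_conjLp ((b.diagonalSemigroup (fun i => (m i)⁻¹) hm).op t u)
    rw [← hconjT] at h1
    filter_upwards [h1] with x hx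
    rw [← RCLike.conj_eq_iff_im, ← RCLike.star_def, ← hx]
  filter_upwards [him, Lp.coeFn_add ((q : 𝕜) • groundStateLp 𝕜 a) (greenOp 𝕜 w),
    Lp.coeFn_smul (q : 𝕜) (groundStateLp 𝕜 a), coeFn_groundStateLp (𝕜 := 𝕜) a, coeFn_greenOp w,
    ae_mem_Ioo_unitIntervalMeasure] with x h0 h1 h2 h3 h4 hx
  refine ⟨?_, h0⟩
  have hx' := Ioo_subset_Icc_self hx
  rw [h1, Pi.add_apply, h2, Pi.smul_apply, h3, h4, smul_eq_mul, ← RCLike.ofReal_mul, map_add,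
    RCLike.ofReal_re]
  have h5 := (norm_greenFun_le w.integrable hx').trans (div_le_div_of_nonneg_right hwn zero_le_two)
  have h6 := (abs_le.1 ((RCLike.abs_re_le_norm _).trans h5)).1
  have h7 : e * (Real.cos a * I) * Real.cos a ≤ q * groundState a x :=
    mul_le_mul hqle (groundState_bounds ha hx').1 hd.le hq0
  have h8 : E * I ≤ e * Real.cos a ^ 2 * I := mul_le_mul_of_nonneg_right hEe hI0
  have h9 : 0 ≤ E * I := mul_nonneg (Real.exp_pos _).le hI0
  -- The ground state part is at least `e cos² a I ≥ E I`, while the remainder is at least `-E I /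
  -- 2`.
  nlinarith

end EventualPositivity

theorem theorem4p3 (𝕜 : Type*) [RCLike 𝕜] :
    IsSelfAdjoint (nonlocalLaplacian 𝕜) ∧
      (∃! T : C0Semigroup 𝕜 (L2UnitInterval 𝕜), T.IsGeneratedBy (nonlocalLaplacian 𝕜)) ∧
      ∀ T : C0Semigroup 𝕜 (L2UnitInterval 𝕜), T.IsGeneratedBy (nonlocalLaplacian 𝕜) →
        T.UniformlyEventuallyPositive := by
  obtain ⟨ι, b, m, hb⟩ :=
    (greenOp_isCompactOperator (𝕜 := 𝕜)).exists_hilbertBasis_eigenvectors greenOp_isSymmetric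
  have hm : ∀ i, 0 ≤ (m i)⁻¹ := fun i => (inv_pos.2 (greenOp_eigenvalue_pos hb i)).le
  have hA := nonlocalLaplacian_eq_iff_inner hb
  refine ⟨nonlocalLaplacian_isSelfAdjoint, ⟨b.diagonalSemigroup _ hm,
    b.diagonalSemigroup_isGeneratedBy _ hm hA, fun T hT => b.eq_diagonalSemigroup _ hm hA hT⟩,
    fun T hT => ?_⟩
  rw [b.eq_diagonalSemigroup _ hm hA hT]
  exact diagonalSemigroup_uniformlyEventuallyPositive hb hm
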